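/- Let $E$ be a (nonempty) Polish space, let $\mathcal P(E)$ be the set of Borel probability measures on $E$ with the topology of weak convergence, and let $\alpha:\mathcal P(E)\to(-\infty,\infty]$ be convex, not identically $\infty$, and such that $\{\nu:\alpha(\nu)\le c\}$ is compact for every $c\in\mathbb R$. For $n\ge1$ and $\nu\in\mathcal P(E^n)$ let $\nu_{0,1}\in\mathcal P(E)$ be the law of the first coordinate under $\nu$ and, for $2\le k\le n$, let $\nu_{k-1,k}(x_1,\dots,x_{k-1})\in\mathcal P(E)$ be a regular conditional law under $\nu$ of the $k$-th coordinate given that the first $k-1$ coordinates are $(x_1,\dots,x_{k-1})$. Define $$\alpha_n(\nu)=\int_{E^n}\sum_{k=1}^n\alpha\big(\nu_{k-1,k}(x_1,\dots,x_{k-1})\big)\,\nu(dx_1,\dots,dx_n),\qquad \rho_n(f)=\sup_{\nu\in\mathcal P(E^n)}\Big(\int_{E^n}f\,d\nu-\alpha_n(\nu)\Big)$$ for measurable $f:E^n\to[-\infty,\infty]$, where $\int f\,d\nu=\int f^+d\nu-\int f^-d\nu$ and $\infty-\infty:=-\infty$. Let $L_n(x_1,\dots,x_n)=\frac1n\sum_{i=1}^n\delta_{x_i}$.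 For continuous $\psi:E\to[0,\infty)$ let $\mathcal P_\psi(E)=\{\nu\in\mathcal P(E):\int\psi\,d\nu<\infty\}$ carry the $\psi$-weak topology, that is, the one generated by the maps $\nu\mapsto\int f\,d\nu$ with $f:E\to\mathbb R$ continuous and $|f|\le1+\psi$. **Theorem 3.1.** Let $\psi:E\to[0,\infty)$ be continuous. (i) If $F:\mathcal P_\psi(E)\to\mathbb R\cup\{\infty\}$ is lower semicontinuous and bounded from below, then $$\liminf_{n\to\infty}\frac1n\rho_n(nF\circ L_n)\ \ge\ \sup_{\nu\in\mathcal P_\psi(E)}\big(F(\nu)-\alpha(\nu)\big).$$ (ii) Suppose also that for every $c\in\mathbb R$ the set $\{\nu\in\mathcal P(E):\alpha(\nu)\le c\}$ is a pre-compact subset of $\mathcal P_\psi(E)$, that is, it is contained in $\mathcal P_\psi(E)$ and its closure in the $\psi$-weak topology is compact. If $F:\mathcal P_\psi(E)\to\mathbb R\cup\{-\infty\}$ is upper semicontinuous and bounded from above, then $$\limsup_{n\to\infty}\frac1n\rho_n(nF\circ L_n)\ \le\ \sup_{\nu\in\mathcal P_\psi(E)}\big(F(\nu)-\alpha(\nu)\big).$$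 (iii) In particular (Theorem 1.1), for every bounded continuous $F:\mathcal P(E)\to\mathbb R$, $$\lim_{n\to\infty}\frac1n\rho_n(nF\circ L_n)=\sup_{\nu\in\mathcal P(E)}\big(F(\nu)-\alpha(\nu)\big).$$ -/

import Mathlib

open MeasureTheory ProbabilityTheory Filter Topology
open scoped ENNReal NNReal BoundedContinuousFunction

/-- Extended integral of `f : X → [-∞, ∞]`, namely `∫ f⁺ - ∫ f⁻`. Subtraction in `EReal` satisfies
`⊤ - ⊤ = ⊥`, so the value is `-∞` whenever both parts have infinite integral. -/
noncomputable def eIntegral {X : Type*} [MeasurableSpace X] (μ : Measure X) (f : X → EReal) :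
    EReal :=
  ((∫⁻ x, (f x).toENNReal ∂μ : ℝ≥0∞) : EReal) - ((∫⁻ x, (-f x).toENNReal ∂μ : ℝ≥0∞) : EReal)

/-- Convexity of a functional on probability measures:
`α (s μ + t ν) ≤ s α μ + t α ν` for all `s, t ≥ 0` with `s + t = 1`. -/
def IsConvexFunctional {E : Type*} [MeasurableSpace E] (α : ProbabilityMeasure E → EReal) : Prop :=
  ∀ (μ ν ξ : ProbabilityMeasure E) (s t : ℝ≥0), s + t = 1 →
    (ξ : Measure E) = s • (μ : Measure E) + t • (ν : Measure E) →
    α ξ ≤ ((s : ℝ) : EReal) * α μ + ((t : ℝ) : EReal) * α ν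

section Chain

variable {E : Type*} [MeasurableSpace E] [StandardBorelSpace E] [Nonempty E]

/-- The first `k` coordinates of a point of `E ^ n`. -/
def initialCoords {n : ℕ} (k : Fin n) (x : Fin n → E) : Fin k → E :=
  fun i => x (Fin.castLE k.isLt.le i)

/-- The disintegration of a law `ν` on `E ^ n`: the (regular) conditional law under `ν` of
coordinate `k` given the preceding coordinates, evaluated at the preceding coordinates of `x`.
Coordinates are numbered from `0`; for `k = 0` nothing precedes, and this is the law of the first
coordinate. -/
noncomputable def condLaw {n : ℕ} (ν : ProbabilityMeasure (Fin n → E)) (k : Fin n)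
    (x : Fin n → E) : ProbabilityMeasure E :=
  ⟨condDistrib (fun y : Fin n → E => y k) (initialCoords k) (ν : Measure (Fin n → E))
    (initialCoords k x), inferInstance⟩

/-- The functional `αₙ(ν) = ∫ ∑ₖ α(ν_{k-1,k}(x₁, …, x_{k-1})) ν(dx)`. -/
noncomputable def alphaN (α : ProbabilityMeasure E → EReal) {n : ℕ}
    (ν : ProbabilityMeasure (Fin n → E)) : EReal :=
  eIntegral (ν : Measure (Fin n → E)) (fun x => ∑ k : Fin n, α (condLaw ν k x))

/-- The conjugate `ρₙ(f) = sup_ν (∫ f dν - αₙ(ν))`, with the convention `∞ - ∞ = -∞`. -/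
noncomputable def rhoN (α : ProbabilityMeasure E → EReal) {n : ℕ} (f : (Fin n → E) → EReal) :
    EReal :=
  ⨆ ν : ProbabilityMeasure (Fin n → E), (eIntegral (ν : Measure (Fin n → E)) f - alphaN α ν)

end Chain

section Psi

variable {E : Type*} [TopologicalSpace E] [MeasurableSpace E]

/-- The set `P_ψ(E)` of probability measures `ν` on `E` with `∫ ψ dν < ∞`. -/
structure PsiProb (ψ : C(E, ℝ≥0)) where
  /-- the underlying probability measure -/
  toProb : ProbabilityMeasure E
  lintegral_lt_top : ∫⁻ x, (ψ x : ℝ≥0∞) ∂(toProb : Measure E) < ∞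

/-- The `ψ`-weak topology: the coarsest one making `ν ↦ ∫ f dν` continuous for every continuous
`f : E → ℝ` with `|f| ≤ 1 + ψ`. -/
noncomputable instance PsiProb.instTopologicalSpace (ψ : C(E, ℝ≥0)) : TopologicalSpace (PsiProb ψ) :=
  ⨅ f : {f : C(E, ℝ) // ∀ x, |f x| ≤ 1 + (ψ x : ℝ)},
    TopologicalSpace.induced (fun ν : PsiProb ψ => ∫ x, f.1 x ∂(ν.toProb : Measure E)) inferInstance

end Psi

section Empirical

variable {E : Type*} [MeasurableSpace E]

/-- The empirical measure `Lₙ(x₁, …, xₙ) = (1/n) ∑ᵢ δ_{xᵢ}`, for `n ≥ 1`. -/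
noncomputable def empirical {n : ℕ} [NeZero n] (x : Fin n → E) : ProbabilityMeasure E :=
  ⟨(n : ℝ≥0∞)⁻¹ • ∑ i, Measure.dirac (x i), ⟨by
    simp only [Measure.smul_apply, Measure.finsetSum_apply, measure_univ, Finset.sum_const,
      Finset.card_univ, Fintype.card_fin, smul_eq_mul, nsmul_eq_mul, mul_one]
    exact ENNReal.inv_mul_cancel (by exact_mod_cast NeZero.ne n) (ENNReal.natCast_ne_top n)⟩⟩

/-- The empirical measure as an element of `P_ψ(E)`. -/
noncomputable def empiricalPsi [TopologicalSpace E] [OpensMeasurableSpace E] (ψ : C(E, ℝ≥0))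
    {n : ℕ} [NeZero n] (x : Fin n → E) : PsiProb ψ where
  toProb := empirical x
  lintegral_lt_top := by
    have hm : Measurable fun y => (ψ y : ℝ≥0∞) := ψ.continuous.measurable.coe_nnreal_ennreal
    simp only [empirical, ProbabilityMeasure.coe_mk, lintegral_smul_measure,
      lintegral_finsetSum_measure, lintegral_dirac' _ hm, smul_eq_mul]
    exact ENNReal.mul_lt_top
      (ENNReal.inv_lt_top.2 (by exact_mod_cast Nat.pos_of_ne_zero (NeZero.ne n)))
      (ENNReal.sum_lt_top.2 fun i _ => ENNReal.coe_lt_top)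

end Empirical

/-! ### The extended integral -/

/-! For a law `ν` on `E ^ n`, let `L` be the average of its conditional laws along a point `x`. For
a bounded test function `f`, the difference `∫ f dLₙ - ∫ f dL` is an average of martingale
increments. These are orthogonal in `L²(ν)`, so the difference has mean absolute value of order `n ^
(-1/2)`, uniformly in `ν`. Thus `Lₙ` is close to `L`, and convexity gives `α(L) ≤ (1/n) ∑ₖ
α(ν_{k-1,k})` (`IsConvexFunctional.average_le`).

Lower bound: product measures `P ^ n` are the competitors. Their conditional laws all equal `P`, so
`αₙ = n α(P)`, and the estimate above is a law of large numbers. Lower semicontinuity controls `F`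
near `P`, and its lower bound controls it elsewhere.

Upper bound: let `s` exceed `sup (F - α)`. Compactness of a sublevel set yields finitely many test
functions and one `ε` such that `F(μ) ≤ α(ν) + s` whenever `μ` is `ε`-close to a `ν` in that set
(`exists_uniform_neighbourhood`). Hence, pointwise, `n F(Lₙ)` is at most `∑ₖ α(ν_{k-1,k}) + n s`
plus a multiple of the deviations between `Lₙ` and `L` (`mul_comp_empiricalPsi_le`). Integrating
against `ν` gives the bound once the expected deviations are small uniformly in the relevant `ν`.

Test functions bounded only by `1 + ψ` are truncated, at the cost of tails `(ψ - R)⁺`. In the upper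
bound convexity makes these tails at most a small multiple of `α + m + 1`
(`exists_lintegral_tail_le`). A law whose integrated positive cost is too large for this to help
satisfies the bound trivially (`sub_alphaN_le_of_le_lintegral`). -/

lemma toENNReal_add_le_of_le_add {f G : EReal} {c : ℝ} {r : ℝ≥0∞} (hf : f ≠ ⊤) (hG : G ≠ ⊥)
    (h : f ≤ G + c + r) :
    f.toENNReal + (-G).toENNReal + ENNReal.ofReal (-c) ≤
      (-f).toENNReal + G.toENNReal + ENNReal.ofReal c + r := by
  induction f with
  | bot => simp
  | top => exact absurd rfl hf
  | coe f =>
  induction G with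
  | bot => exact absurd rfl hG
  | top => simp
  | coe G =>
  induction r with
  | top => simp
  | coe r =>
  have h' : f ≤ G + c + r := by
    have : (((r : ℝ≥0) : ℝ≥0∞) : EReal) = ((r : ℝ) : EReal) := rfl
    rw [this] at h
    exact_mod_cast h
  rw [← EReal.coe_neg, ← EReal.coe_neg, EReal.toENNReal_of_ne_top (EReal.coe_ne_top _),
    EReal.toENNReal_of_ne_top (EReal.coe_ne_top _), EReal.toENNReal_of_ne_top (EReal.coe_ne_top _),
    EReal.toENNReal_of_ne_top (EReal.coe_ne_top _), ← ENNReal.ofReal_coe_nnreal]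
  simp only [EReal.toReal_coe]
  have hmax : ∀ x : ℝ, ENNReal.ofReal x = ENNReal.ofReal (max x 0) := fun x => by
    rcases le_total x 0 with hx | hx <;> simp [hx, ENNReal.ofReal_of_nonpos]
  rw [hmax f, hmax G, hmax c, hmax (-f), hmax (-G), hmax (-c)]
  rw [← ENNReal.ofReal_add (by positivity) (by positivity),
    ← ENNReal.ofReal_add (by positivity) (by positivity),
    ← ENNReal.ofReal_add (by positivity) (by positivity),
    ← ENNReal.ofReal_add (by positivity) (by positivity),
    ← ENNReal.ofReal_add (by positivity) (by positivity)]
  apply ENNReal.ofReal_le_ofReal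
  have key : ∀ x : ℝ, max x 0 = max (-x) 0 + x := fun x => by
    rcases le_total x 0 with hx | hx <;> simp [hx]
  linarith [key f, key G, key c]

/-- Here `a, a'` stand for the integrals of `f⁺, f⁻` and `b', b` for those of `G⁺, G⁻`. Finiteness
of `a` and `b` excludes every ambiguous `∞ - ∞`, so the inequality can be integrated as a sum of
nonnegative terms and rearranged only afterwards. -/
lemma coe_sub_sub_le_of_add_le {a a' b b' r : ℝ≥0∞} {c : ℝ} (ha : a ≠ ⊤) (hb : b ≠ ⊤)
    (h : a + b + ENNReal.ofReal (-c) ≤ a' + b' + ENNReal.ofReal c + r) :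
    ((a : EReal) - a') - ((b' : EReal) - b) ≤ c + r := by
  lift a to ℝ≥0 using ha
  lift b to ℝ≥0 using hb
  induction a' with
  | top => simp
  | coe a' =>
  induction b' with
  | top =>
    have : ((⊤ : ℝ≥0∞) : EReal) - ((b : ℝ≥0∞) : EReal) = ⊤ := by
      exact EReal.top_sub_coe (b : ℝ)
    rw [this]; simp
  | coe b' =>
  induction r with
  | top => simp
  | coe r =>
  have e : ∀ x : ℝ≥0, ((x : ℝ≥0∞) : EReal) = ((x : ℝ) : EReal) := fun _ => rfl
  simp only [e]
  norm_cast
  simp only [ENNReal.ofReal] at h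
  norm_cast at h
  have h' : (a : ℝ) + b + (-c).toNNReal ≤ a' + b' + c.toNNReal + r := by exact_mod_cast h
  have key : (c.toNNReal : ℝ) = (-c).toNNReal + c := by
    rcases le_total c 0 with hx | hx <;> simp [hx]
  linarith

section eIntegral

variable {X : Type*} [MeasurableSpace X] {μ : Measure X}

lemma lintegral_toENNReal_le_ofReal [IsProbabilityMeasure μ] {f : X → EReal} {C : ℝ}
    (hf : ∀ x, f x ≤ C) : ∫⁻ x, (f x).toENNReal ∂μ ≤ ENNReal.ofReal C := by
  calc _ ≤ ∫⁻ _, ENNReal.ofReal C ∂μ := lintegral_mono fun x => by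
        have := EReal.toENNReal_le_toENNReal (hf x)
        simpa [EReal.toENNReal_of_ne_top] using this
    _ = _ := by simp

/-- Only `f` and `R` need to be measurable here. -/
lemma eIntegral_sub_le_add [IsProbabilityMeasure μ] {f G : X → EReal} {C m c : ℝ} {R : X → ℝ≥0∞}
    (hf : Measurable f) (hR : Measurable R) (hfC : ∀ x, f x ≤ C)
    (hG : ∀ x, ((-m : ℝ) : EReal) ≤ G x) (h : ∀ᵐ x ∂μ, f x ≤ G x + c + R x) :
    eIntegral μ f - eIntegral μ G ≤ c + ((∫⁻ x, R x ∂μ : ℝ≥0∞) : EReal) := by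
  have hGm : ∀ x, -G x ≤ (m : EReal) := fun x => by
    rw [EReal.neg_le, ← EReal.coe_neg]; exact hG x
  refine coe_sub_sub_le_of_add_le ((lintegral_toENNReal_le_ofReal hfC).trans_lt
    ENNReal.ofReal_lt_top).ne ((lintegral_toENNReal_le_ofReal hGm).trans_lt
    ENNReal.ofReal_lt_top).ne ?_
  have h1 : ∫⁻ x, (f x).toENNReal + (-G x).toENNReal + ENNReal.ofReal (-c) ∂μ ≤
      ∫⁻ x, (-f x).toENNReal + (G x).toENNReal + ENNReal.ofReal c + R x ∂μ := by
    refine lintegral_mono_ae (h.mono fun x hx => toENNReal_add_le_of_le_add ?_ ?_ hx)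
    · exact ((hfC x).trans_lt (EReal.coe_lt_top _)).ne
    · exact ((EReal.bot_lt_coe _).trans_le (hG x)).ne'
  rw [lintegral_add_right _ hR, lintegral_add_right _ measurable_const,
    lintegral_add_right _ measurable_const, lintegral_add_left (show Measurable fun x => (-f x).toENNReal from hf.neg.ereal_toENNReal),
    lintegral_add_left hf.ereal_toENNReal] at h1
  simpa using h1

lemma eIntegral_const [IsProbabilityMeasure μ] (c : EReal) : eIntegral μ (fun _ => c) = c := by
  simp only [eIntegral, lintegral_const, measure_univ, mul_one]
  rw [EReal.coe_toENNReal_eq_max, EReal.coe_toENNReal_eq_max]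
  rcases le_total c 0 with h | h
  · simp [h]
  · have : -c ≤ 0 := by simpa using EReal.neg_le_neg_iff.2 h
    simp [h, this]

lemma eIntegral_congr_ae {f g : X → EReal} (h : f =ᵐ[μ] g) : eIntegral μ f = eIntegral μ g := by
  simp only [eIntegral]
  congr 2
  · exact lintegral_congr_ae (h.fun_comp EReal.toENNReal)
  · exact lintegral_congr_ae (h.fun_comp fun y => (-y).toENNReal)

lemma eIntegral_le_of_le [IsProbabilityMeasure μ] {f : X → EReal} {C : ℝ}
    (hf : ∀ x, f x ≤ C) : eIntegral μ f ≤ C := by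
  rw [← eIntegral_const (μ := μ) (C : EReal)]
  refine EReal.sub_le_sub ?_ ?_
  · exact EReal.coe_ennreal_le_coe_ennreal_iff.2
      (lintegral_mono fun x => EReal.toENNReal_le_toENNReal (hf x))
  · exact EReal.coe_ennreal_le_coe_ennreal_iff.2
      (lintegral_mono fun x => EReal.toENNReal_le_toENNReal (EReal.neg_le_neg_iff.2 (hf x)))

end eIntegral

/-! ### The disintegration of a law on `Fin n → E` -/

lemma abs_integral_le_of_abs_le {X : Type*} [MeasurableSpace X] (μ : Measure X)
    [IsProbabilityMeasure μ] {g : X → ℝ} {B : ℝ} (hB : ∀ y, |g y| ≤ B) : |∫ y, g y ∂μ| ≤ B := by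
  simpa using norm_integral_le_of_norm_le_const (μ := μ) (f := g) (Eventually.of_forall hB)

section Chain

variable {E : Type*} [MeasurableSpace E] {n : ℕ}

lemma measurable_initialCoords (k : Fin n) :
    Measurable (initialCoords k : (Fin n → E) → Fin k → E) :=
  measurable_pi_lambda _ fun _ => measurable_pi_apply _

variable [StandardBorelSpace E] [Nonempty E]

/-- This is the tower property: mixing the conditional laws of coordinate `k` over the past recovers
its marginal. -/
lemma lintegral_condLaw (ν : ProbabilityMeasure (Fin n → E)) (k : Fin n) {h : E → ℝ≥0∞}
    (hh : Measurable h) :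
    ∫⁻ x, ∫⁻ y, h y ∂(condLaw ν k x : Measure E) ∂(ν : Measure (Fin n → E)) =
      ∫⁻ x, h (x k) ∂(ν : Measure (Fin n → E)) := by
  have h1 := condDistrib_comp_map (μ := (ν : Measure (Fin n → E)))
    (measurable_initialCoords (E := E) k).aemeasurable (measurable_pi_apply k).aemeasurable
  have h2 : ∫⁻ x, h (x k) ∂(ν : Measure (Fin n → E)) =
      ∫⁻ y, h y ∂((ν : Measure (Fin n → E)).map fun y => y k) :=
    (lintegral_map hh (measurable_pi_apply k)).symm
  rw [h2, ← h1, Measure.lintegral_bind (Kernel.aemeasurable _) hh.aemeasurable,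
    lintegral_map hh.lintegral_kernel (measurable_initialCoords k)]
  rfl

lemma measurable_lintegral_condLaw (ν : ProbabilityMeasure (Fin n → E)) (k : Fin n) {h : E → ℝ≥0∞}
    (hh : Measurable h) : Measurable fun x => ∫⁻ y, h y ∂(condLaw ν k x : Measure E) :=
  hh.lintegral_kernel.comp (measurable_initialCoords k)

/-- The centred increment `g(xₖ) - ∫ g dν_{k-1,k}(x₁, …, x_{k-1})`. -/
noncomputable def condIncrement (ν : ProbabilityMeasure (Fin n → E)) (g : E → ℝ) (k : Fin n)
    (x : Fin n → E) : ℝ :=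
  g (x k) - ∫ y, g y ∂(condLaw ν k x : Measure E)

lemma measurable_condIncrement (ν : ProbabilityMeasure (Fin n → E)) {g : E → ℝ}
    (hg : Measurable g) (k : Fin n) : Measurable (condIncrement ν g k) := by
  refine (hg.comp (measurable_pi_apply k)).sub ?_
  have h : StronglyMeasurable fun a => ∫ y, g y ∂(condDistrib (fun y : Fin n → E => y k)
      (initialCoords k) (ν : Measure (Fin n → E)) a) :=
    hg.stronglyMeasurable.comp_measurable measurable_snd |>.integral_kernel_prod_right'
  exact h.measurable.comp (measurable_initialCoords k)

lemma abs_condIncrement_le (ν : ProbabilityMeasure (Fin n → E)) {g : E → ℝ} {B : ℝ}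
    (hB : ∀ y, |g y| ≤ B) (k : Fin n) (x : Fin n → E) : |condIncrement ν g k x| ≤ 2 * B := by
  have h : |∫ y, g y ∂(condLaw ν k x : Measure E)| ≤ B := 
    abs_integral_le_of_abs_le _ hB
  calc _ ≤ |g (x k)| + |∫ y, g y ∂(condLaw ν k x : Measure E)| := abs_sub _ _
    _ ≤ _ := by linarith [hB (x k)]

/-- Given the past, the increment has conditional mean zero, and `φ` depends on the past only:
integrate coordinate `k` first. -/
lemma integral_mul_condIncrement (ν : ProbabilityMeasure (Fin n → E)) {g : E → ℝ} {B C : ℝ}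
    (hg : Measurable g) (hB : ∀ y, |g y| ≤ B) (k : Fin n) {φ : (Fin k → E) → ℝ}
    (hφ : Measurable φ) (hC : ∀ a, |φ a| ≤ C) :
    ∫ x, φ (initialCoords k x) * condIncrement ν g k x ∂(ν : Measure (Fin n → E)) = 0 := by
  set μ := (ν : Measure (Fin n → E))
  set κ := condDistrib (fun y : Fin n → E => y k) (initialCoords k) μ
  have hκ : Measurable fun a => ∫ y, g y ∂(κ a) :=
    (hg.stronglyMeasurable.comp_measurable measurable_snd |>.integral_kernel_prod_right').measurable
  let u : (Fin k → E) × E → ℝ := fun p => φ p.1 * (g p.2 - ∫ y, g y ∂(κ p.1))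
  have hu : Measurable u := (hφ.comp measurable_fst).mul
    ((hg.comp measurable_snd).sub (hκ.comp measurable_fst))
  have hκB : ∀ a, |∫ y, g y ∂(κ a)| ≤ B := fun a => abs_integral_le_of_abs_le _ hB
  have hub : ∀ p, ‖u p‖ ≤ C * (B + B) := fun p => by
    rw [Real.norm_eq_abs, abs_mul]
    exact mul_le_mul (hC _) ((abs_sub _ _).trans (add_le_add (hB _) (hκB _))) (abs_nonneg _)
      ((abs_nonneg _).trans (hC p.1))
  have hmeas : Measurable fun x : Fin n → E => (initialCoords k x, x k) :=
    (measurable_initialCoords k).prodMk (measurable_pi_apply k)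
  have h1 : ∫ x, φ (initialCoords k x) * condIncrement ν g k x ∂μ =
      ∫ p, u p ∂(μ.map fun x => (initialCoords k x, x k)) := by
    rw [integral_map hmeas.aemeasurable hu.aestronglyMeasurable]; rfl
  rw [h1, ← compProd_map_condDistrib (measurable_pi_apply k).aemeasurable]
  have : IsProbabilityMeasure (μ.map (initialCoords k : (Fin n → E) → Fin k → E)) :=
    Measure.isProbabilityMeasure_map (measurable_initialCoords k).aemeasurable
  rw [Measure.integral_compProd (Integrable.of_bound hu.aestronglyMeasurable _
    (Eventually.of_forall hub))]
  refine integral_eq_zero_of_ae (Eventually.of_forall fun a => ?_)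
  have hgi : Integrable g (κ a) :=
    Integrable.of_bound hg.aestronglyMeasurable B (Eventually.of_forall hB)
  simp only [u]
  rw [integral_const_mul, integral_sub hgi (integrable_const _)]
  simp [κ]

lemma integral_condIncrement_mul_condIncrement (ν : ProbabilityMeasure (Fin n → E)) {g : E → ℝ}
    {B : ℝ} (hg : Measurable g) (hB : ∀ y, |g y| ≤ B) {j k : Fin n} (hjk : j < k) :
    ∫ x, condIncrement ν g j x * condIncrement ν g k x ∂(ν : Measure (Fin n → E)) = 0 := by
  -- Since `j < k`, increment `j` is a function of the coordinates before `k`; `r` forgets those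
  -- from `j` on.
  let r : (Fin k → E) → Fin j → E := fun a i => a (Fin.castLE (Fin.le_of_lt hjk) i)
  have hr : Measurable r := measurable_pi_lambda _ fun _ => measurable_pi_apply _
  let φ : (Fin k → E) → ℝ := fun a => g (a ⟨j, hjk⟩) -
    ∫ y, g y ∂(condDistrib (fun y : Fin n → E => y j) (initialCoords j)
      (ν : Measure (Fin n → E)) (r a))
  have hφ : Measurable φ := by
    refine (hg.comp (measurable_pi_apply _)).sub (Measurable.comp (g := fun b => ∫ y, g y ∂(condDistrib
      (fun y : Fin n → E => y j) (initialCoords j) (ν : Measure (Fin n → E)) b)) ?_ hr)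
    exact (hg.stronglyMeasurable.comp_measurable measurable_snd
      |>.integral_kernel_prod_right').measurable
  have hφB : ∀ a, |φ a| ≤ B + B := fun a => (abs_sub _ _).trans (add_le_add (hB _)
    (abs_integral_le_of_abs_le _ hB))
  exact integral_mul_condIncrement ν hg hB k hφ hφB

/-- Expanding the square, the cross terms vanish by orthogonality and each of the `n` diagonal terms
is at most `(2B)²`. -/
lemma integral_sum_condIncrement_sq_le (ν : ProbabilityMeasure (Fin n → E)) {g : E → ℝ} {B : ℝ}
    (hg : Measurable g) (hB : ∀ y, |g y| ≤ B) :
    ∫ x, (∑ k, condIncrement ν g k x) ^ 2 ∂(ν : Measure (Fin n → E)) ≤ n * (2 * B) ^ 2 := by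
  have hint : ∀ j k, Integrable (fun x => condIncrement ν g j x * condIncrement ν g k x)
      (ν : Measure (Fin n → E)) := fun j k => by
    refine Integrable.of_bound ((measurable_condIncrement ν hg j).mul
      (measurable_condIncrement ν hg k)).aestronglyMeasurable (2 * B * (2 * B))
      (Eventually.of_forall fun x => ?_)
    rw [norm_mul]
    exact mul_le_mul (abs_condIncrement_le ν hB j x) (abs_condIncrement_le ν hB k x)
      (norm_nonneg _) ((abs_nonneg _).trans (abs_condIncrement_le ν hB j x))
  simp only [sq, Finset.sum_mul_sum]
  rw [integral_finsetSum _ fun j _ => integrable_finsetSum _ fun k _ => hint j k]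
  calc _ ≤ ∑ _j : Fin n, 2 * B * (2 * B) := Finset.sum_le_sum fun j _ => ?_
    _ = _ := by simp
  rw [integral_finsetSum _ fun k _ => hint j k, Finset.sum_eq_single j]
  · calc _ ≤ ∫ _, 2 * B * (2 * B) ∂(ν : Measure (Fin n → E)) :=
          integral_mono (hint j j) (integrable_const _) fun x => by
            have := abs_le.1 (abs_condIncrement_le ν hB j x)
            nlinarith
      _ = _ := by simp
  · intro k _ hk
    rcases lt_or_gt_of_ne hk with h | h
    · simp_rw [mul_comm (condIncrement ν g j _)]
      exact integral_condIncrement_mul_condIncrement ν hg hB h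
    · exact integral_condIncrement_mul_condIncrement ν hg hB h
  · simp

/-- A weak law of large numbers for the centred increments. -/
lemma lintegral_average_condIncrement_le (ν : ProbabilityMeasure (Fin n → E)) {g : E → ℝ} {B η : ℝ}
    (hg : Measurable g) (hB : ∀ y, |g y| ≤ B) (hη : 0 < η) :
    ∫⁻ x, ENNReal.ofReal |(n : ℝ)⁻¹ * ∑ k, condIncrement ν g k x| ∂(ν : Measure (Fin n → E)) ≤
      ENNReal.ofReal (η + (2 * B) ^ 2 / (η * n)) := by
  rcases Nat.eq_zero_or_pos n with rfl | hn
  · simp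
  have hn' : (0 : ℝ) < n := by exact_mod_cast hn
  have hsum : Measurable fun x => ∑ k, condIncrement ν g k x :=
    Finset.measurable_sum _ fun k _ => measurable_condIncrement ν hg k
  have hsq : Integrable (fun x => (∑ k, condIncrement ν g k x) ^ 2) (ν : Measure (Fin n → E)) := by
    refine Integrable.of_bound (hsum.pow_const 2).aestronglyMeasurable ((n * (2 * B)) ^ 2)
      (Eventually.of_forall fun x => ?_)
    rw [norm_pow]
    refine pow_le_pow_left₀ (norm_nonneg _) ((norm_sum_le _ _).trans ?_) 2
    calc _ ≤ ∑ _k : Fin n, 2 * B := Finset.sum_le_sum fun k _ => abs_condIncrement_le ν hB k x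
      _ = _ := by simp
  -- The elementary bound `y ≤ η + y² / η` turns the second moment into a first-moment bound.
  have hpt : ∀ x, |(n : ℝ)⁻¹ * ∑ k, condIncrement ν g k x| ≤
      η + (∑ k, condIncrement ν g k x) ^ 2 / (η * n ^ 2) := fun x => by
    set s := ∑ k, condIncrement ν g k x
    have e : s ^ 2 / (η * n ^ 2) = |(n : ℝ)⁻¹ * s| ^ 2 / η := by
      rw [sq_abs]; field_simp
    rw [e]
    set y := |(n : ℝ)⁻¹ * s|
    have hy : 0 ≤ y := abs_nonneg _
    have : y ^ 2 / η = y * (y / η) := by ring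
    rcases le_total y η with h | h
    · have : 0 ≤ y ^ 2 / η := by positivity
      linarith
    · have : 1 ≤ y / η := (one_le_div hη).2 h
      nlinarith
  calc _ ≤ ∫⁻ x, ENNReal.ofReal (η + (∑ k, condIncrement ν g k x) ^ 2 / (η * n ^ 2))
        ∂(ν : Measure (Fin n → E)) := lintegral_mono fun x => ENNReal.ofReal_le_ofReal (hpt x)
    _ = ENNReal.ofReal (∫ x, η + (∑ k, condIncrement ν g k x) ^ 2 / (η * n ^ 2)
        ∂(ν : Measure (Fin n → E))) := by
      refine (ofReal_integral_eq_lintegral_ofReal ((integrable_const η).add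
        (hsq.div_const (η * n ^ 2))) (Eventually.of_forall fun x => ?_)).symm
      simp only [Pi.zero_apply, Pi.add_apply]
      positivity
    _ ≤ _ := by
      apply ENNReal.ofReal_le_ofReal
      rw [integral_add (integrable_const _) (hsq.div_const _), integral_div]
      simp only [integral_const, probReal_univ, one_smul]
      have h := integral_sum_condIncrement_sq_le ν hg hB
      have : (2 * B) ^ 2 / (η * n) = n * (2 * B) ^ 2 / (η * n ^ 2) := by field_simp
      rw [this]
      gcongr

/-- Coordinate `k` is independent of its predecessors, so the constant kernel `P` disintegrates the
joint law, and conditional laws are almost everywhere unique. -/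
lemma condLaw_pi (P : ProbabilityMeasure E) {ν : ProbabilityMeasure (Fin n → E)}
    (hν : (ν : Measure (Fin n → E)) = Measure.pi fun _ => (P : Measure E)) :
    ∀ᵐ x ∂(ν : Measure (Fin n → E)), ∀ k, condLaw ν k x = P := by
  rw [ae_all_iff]
  intro k
  have hind : IndepFun (initialCoords k : (Fin n → E) → Fin k → E) (fun y => y k)
      (ν : Measure (Fin n → E)) := by
    have h1 : iIndepFun (fun (i : Fin n) (y : Fin n → E) => y i) (ν : Measure (Fin n → E)) := by
      rw [hν]
      exact iIndepFun_pi (X := fun _ => id) fun _ => aemeasurable_id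
    have h2 := h1.indepFun_finset (Finset.univ.filter (· < k)) {k} (by simp)
      fun i => measurable_pi_apply i
    have h3 : Measurable fun (a : (Finset.univ.filter (· < k) : Finset (Fin n)) → E) (i : Fin k) =>
        a ⟨Fin.castLE k.isLt.le i, by
          simpa using Fin.lt_def.2 i.isLt⟩ :=
      measurable_pi_lambda _ fun _ => measurable_pi_apply _
    have h4 : Measurable fun (a : ({k} : Finset (Fin n)) → E) => a ⟨k, by simp⟩ :=
      measurable_pi_apply _
    exact h2.comp h3 h4
  have hmap : (ν : Measure (Fin n → E)).map (fun y => y k) = P := by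
    rw [hν]; exact (measurePreserving_eval (fun _ => (P : Measure E)) k).map_eq
  have h := condDistrib_ae_eq_of_measure_eq_compProd (μ := (ν : Measure (Fin n → E)))
    (initialCoords k) (measurable_pi_apply k).aemeasurable
    (κ := Kernel.const (Fin k → E) (P : Measure E)) (by
      rw [(indepFun_iff_map_prod_eq_prod_map_map (measurable_initialCoords k).aemeasurable
        (measurable_pi_apply k).aemeasurable).1 hind, Measure.compProd_const, hmap])
  filter_upwards [ae_of_ae_map (measurable_initialCoords k).aemeasurable h] with x hx
  exact Subtype.ext hx

lemma alphaN_pi (α : ProbabilityMeasure E → EReal) (P : ProbabilityMeasure E)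
    {ν : ProbabilityMeasure (Fin n → E)}
    (hν : (ν : Measure (Fin n → E)) = Measure.pi fun _ => (P : Measure E)) :
    alphaN α ν = n * α P := by
  rw [alphaN, eIntegral_congr_ae (g := fun _ => (n : EReal) * α P), eIntegral_const]
  filter_upwards [condLaw_pi P hν] with x hx
  simp [hx]

end Chain

/-! ### The `ψ`-weak topology -/

section PsiWeak

variable {E : Type*} [TopologicalSpace E] [MeasurableSpace E] {ψ : C(E, ℝ≥0)}

/-- The test functions of the `ψ`-weak topology. -/
abbrev PsiTest (ψ : C(E, ℝ≥0)) : Type _ := {f : C(E, ℝ) // ∀ x, |f x| ≤ 1 + (ψ x : ℝ)}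

namespace PsiProb

lemma continuous_integral (f : PsiTest ψ) :
    Continuous fun ν : PsiProb ψ => ∫ x, f.1 x ∂(ν.toProb : Measure E) :=
  continuous_iff_le_induced.2 (iInf_le _ f)

lemma exists_finset_of_mem_nhds {ν : PsiProb ψ} {U : Set (PsiProb ψ)} (hU : U ∈ 𝓝 ν) :
    ∃ T : Finset (PsiTest ψ), ∃ ε : ℝ, 0 < ε ∧ ∀ μ : PsiProb ψ,
      (∀ f ∈ T, |∫ x, f.1 x ∂(μ.toProb : Measure E) - ∫ x, f.1 x ∂(ν.toProb : Measure E)| < ε) →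
        μ ∈ U := by
  have hnhds : 𝓝 ν = ⨅ f : PsiTest ψ, comap
      (fun ν : PsiProb ψ => ∫ x, f.1 x ∂(ν.toProb : Measure E))
      (𝓝 (∫ x, f.1 x ∂(ν.toProb : Measure E))) :=
    nhds_iInf.trans (iInf_congr fun f => nhds_induced _ _)
  rw [hnhds, Filter.mem_iInf] at hU
  obtain ⟨I, hI, V, hV, rfl⟩ := hU
  have := hI.to_subtype
  have hball : ∀ i : I, ∃ e : ℝ, 0 < e ∧ ∀ μ : PsiProb ψ,
      |∫ x, i.1.1 x ∂(μ.toProb : Measure E) - ∫ x, i.1.1 x ∂(ν.toProb : Measure E)| < e →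
        μ ∈ V i := fun i => by
    obtain ⟨W, hW, hWV⟩ := hV i
    obtain ⟨e, he, hb⟩ := Metric.mem_nhds_iff.1 hW
    exact ⟨e, he, fun μ hμ => hWV (hb (by simpa [Real.dist_eq] using hμ))⟩
  choose e he hb using hball
  -- Any small enough positive `ε` works; arguing along `0+` also covers an empty index set.
  obtain ⟨ε, hε, hε0⟩ : ∃ ε : ℝ, (∀ i, ε ∈ Set.Ioo 0 (e i)) ∧ 0 < ε :=
    ((eventually_all.2 fun i => Ioo_mem_nhdsGT (he i)).and self_mem_nhdsWithin).exists
  exact ⟨hI.toFinset, ε, hε0, fun μ hμ => Set.mem_iInter.2 fun i =>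
    hb i μ ((hμ i.1 (hI.mem_toFinset.2 i.2)).trans (hε i).2)⟩

variable [OpensMeasurableSpace E]

lemma integrable_of_le {P : Measure E} [IsProbabilityMeasure P]
    (hP : ∫⁻ x, (ψ x : ℝ≥0∞) ∂P < ∞) {f : E → ℝ} (hm : Measurable f)
    (hf : ∀ x, |f x| ≤ 1 + (ψ x : ℝ)) : Integrable f P := by
  have hψ : Integrable (fun x => (ψ x : ℝ)) P := by
    refine ⟨(NNReal.continuous_coe.comp ψ.continuous).measurable.aestronglyMeasurable, ?_⟩
    simpa [HasFiniteIntegral] using hP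
  exact ((integrable_const (1 : ℝ)).add hψ).mono' hm.aestronglyMeasurable (Eventually.of_forall hf)

lemma continuous_toProb : Continuous (toProb : PsiProb ψ → ProbabilityMeasure E) := by
  rw [ProbabilityMeasure.continuous_iff_forall_continuous_integral]
  intro f
  -- Rescaling by `‖f‖ + 1`, which is nonzero even for `f = 0`, makes a bounded function a `ψ`-test
  -- function.
  have hc : 0 < ‖f‖ + 1 := by positivity
  have hf : ∀ x, |((‖f‖ + 1)⁻¹ • f.toContinuousMap) x| ≤ 1 + (ψ x : ℝ) := fun x => by
    have h1 : |f x| ≤ ‖f‖ := f.norm_coe_le_norm x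
    have h2 : (‖f‖ + 1)⁻¹ * |f x| ≤ 1 := by
      rw [inv_mul_le_one₀ hc]; linarith
    have h3 : 0 ≤ (ψ x : ℝ) := (ψ x).2
    simp only [ContinuousMap.smul_apply, smul_eq_mul, abs_mul, abs_of_pos (inv_pos.2 hc)]
    exact h2.trans (by linarith)
  have h := (continuous_integral (ψ := ψ) ⟨_, hf⟩).const_mul (‖f‖ + 1)
  convert h using 2 with ν
  simp only [ContinuousMap.smul_apply, smul_eq_mul]
  rw [integral_const_mul, ← mul_assoc, mul_inv_cancel₀ hc.ne', one_mul]
  rfl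

/-- A probability measure as an element of `P₀(E)`. -/
def ofProb (ν : ProbabilityMeasure E) : PsiProb (0 : C(E, ℝ≥0)) := ⟨ν, by simp⟩

lemma continuous_ofProb : Continuous (ofProb : ProbabilityMeasure E → PsiProb (0 : C(E, ℝ≥0))) := by
  refine continuous_iInf_rng.2 fun f => continuous_induced_rng.2 ?_
  exact ProbabilityMeasure.continuous_integral_boundedContinuousFunction
    (BoundedContinuousFunction.ofNormedAddCommGroup f.1 f.1.continuous 1
      fun x => by simpa using f.2 x)

lemma measurable_tail (ψ : C(E, ℝ≥0)) (R : ℕ) : Measurable fun x => ((ψ x - R : ℝ≥0) : ℝ≥0∞) :=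
  (ψ.continuous.measurable.sub_const _).coe_nnreal_ennreal

/-- The functions `(ψ - R)⁺` are uniformly small on a compact set as `R → ∞`. -/
lemma exists_lintegral_tail_lt {K : Set (PsiProb ψ)} (hK : IsCompact K) {δ : ℝ≥0∞} (hδ : 0 < δ) :
    ∃ R : ℕ, ∀ ν ∈ K, ∫⁻ x, ((ψ x - R : ℝ≥0) : ℝ≥0∞) ∂(ν.toProb : Measure E) < δ := by
  refine hK.induction_on (p := fun s => ∃ R : ℕ, ∀ ν ∈ s,
    ∫⁻ x, ((ψ x - R : ℝ≥0) : ℝ≥0∞) ∂(ν.toProb : Measure E) < δ) ⟨0, by simp⟩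
    (fun s t hst ⟨R, hR⟩ => ⟨R, fun ν hν => hR ν (hst hν)⟩) ?_ fun ν _ => ?_
  · rintro s t ⟨R, hR⟩ ⟨R', hR'⟩
    have hmono : ∀ {R₁ R₂ : ℕ}, R₁ ≤ R₂ → ∀ ν : PsiProb ψ,
        ∫⁻ x, ((ψ x - R₂ : ℝ≥0) : ℝ≥0∞) ∂(ν.toProb : Measure E) ≤
          ∫⁻ x, ((ψ x - R₁ : ℝ≥0) : ℝ≥0∞) ∂(ν.toProb : Measure E) := fun h ν =>
      lintegral_mono fun x => ENNReal.coe_le_coe.2 (tsub_le_tsub_left (by exact_mod_cast h) _)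
    refine ⟨max R R', fun ν hν => ?_⟩
    rcases hν with hν | hν
    · exact (hmono (le_max_left _ _) ν).trans_lt (hR ν hν)
    · exact (hmono (le_max_right _ _) ν).trans_lt (hR' ν hν)
  · have hlim : Tendsto (fun R : ℕ => ∫⁻ x, ((ψ x - R : ℝ≥0) : ℝ≥0∞) ∂(ν.toProb : Measure E))
        atTop (𝓝 (∫⁻ _, 0 ∂(ν.toProb : Measure E))) := by
      refine tendsto_lintegral_of_dominated_convergence (fun x => (ψ x : ℝ≥0∞))
        (measurable_tail ψ) (fun R => Eventually.of_forall fun x =>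
          ENNReal.coe_le_coe.2 tsub_le_self) ν.lintegral_lt_top.ne
        (Eventually.of_forall fun x => ?_)
      obtain ⟨N, hN⟩ := exists_nat_ge (ψ x)
      refine tendsto_const_nhds.congr' ?_
      filter_upwards [eventually_ge_atTop N] with R hR
      rw [tsub_eq_zero_of_le (hN.trans (by exact_mod_cast hR))]
      rfl
    rw [lintegral_zero] at hlim
    obtain ⟨R, hR⟩ := (hlim.eventually_lt_const hδ).exists
    -- The tail `(ψ - R)⁺` is itself a test function, so its integral is continuous and the bound at
    -- `ν` persists nearby.
    let h : C(E, ℝ) := ⟨fun x => ((ψ x - R : ℝ≥0) : ℝ),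
      NNReal.continuous_coe.comp (ψ.continuous.sub continuous_const)⟩
    have hh : ∀ x, |h x| ≤ 1 + (ψ x : ℝ) := fun x => by
      have h1 : ((ψ x - R : ℝ≥0) : ℝ) ≤ ψ x := NNReal.coe_le_coe.2 tsub_le_self
      have h2 : |h x| = ((ψ x - R : ℝ≥0) : ℝ) := abs_of_nonneg (NNReal.coe_nonneg _)
      linarith
    have heq : ∀ μ : PsiProb ψ, ∫⁻ x, ((ψ x - R : ℝ≥0) : ℝ≥0∞) ∂(μ.toProb : Measure E) =
        ENNReal.ofReal (∫ x, h x ∂(μ.toProb : Measure E)) := fun μ =>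
      lintegral_coe_eq_integral _ (integrable_of_le μ.lintegral_lt_top h.continuous.measurable hh)
    have hcont : Continuous fun μ : PsiProb ψ =>
        ∫⁻ x, ((ψ x - R : ℝ≥0) : ℝ≥0∞) ∂(μ.toProb : Measure E) := by
      simp_rw [heq]
      exact ENNReal.continuous_ofReal.comp (continuous_integral ⟨h, hh⟩)
    exact ⟨_, mem_nhdsWithin_of_mem_nhds (hcont.continuousAt.eventually_lt_const hR), R,
      fun μ hμ => hμ⟩

end PsiProb

end PsiWeak

/-! ### Averages of laws -/

section Average

variable {E : Type*} [MeasurableSpace E]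

/-- The average `(1/n) ∑ᵢ Pᵢ` of `n ≥ 1` laws. -/
noncomputable def averageLaw {n : ℕ} [NeZero n] (P : Fin n → ProbabilityMeasure E) :
    ProbabilityMeasure E :=
  ⟨(n : ℝ≥0∞)⁻¹ • ∑ i, (P i : Measure E), ⟨by
    simp only [Measure.smul_apply, Measure.finsetSum_apply, measure_univ, Finset.sum_const,
      Finset.card_univ, Fintype.card_fin, smul_eq_mul, nsmul_eq_mul, mul_one]
    exact ENNReal.inv_mul_cancel (by exact_mod_cast NeZero.ne n) (ENNReal.natCast_ne_top n)⟩⟩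

lemma integral_averageLaw {n : ℕ} [NeZero n] (P : Fin n → ProbabilityMeasure E) {f : E → ℝ}
    (hf : ∀ i, Integrable f (P i : Measure E)) :
    ∫ x, f x ∂(averageLaw P : Measure E) = (n : ℝ)⁻¹ * ∑ i, ∫ x, f x ∂(P i : Measure E) := by
  simp only [averageLaw, ProbabilityMeasure.coe_mk]
  rw [integral_smul_measure, integral_finsetSum_measure fun i _ => hf i]
  simp

lemma integral_empirical {n : ℕ} [NeZero n] (x : Fin n → E) {f : E → ℝ} (hf : Measurable f) :
    ∫ y, f y ∂(empirical x : Measure E) = (n : ℝ)⁻¹ * ∑ i, f (x i) := by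
  have h := integral_averageLaw (fun i => (⟨Measure.dirac (x i), inferInstance⟩ :
    ProbabilityMeasure E)) (f := f) fun i => by
      refine ⟨hf.aestronglyMeasurable, ?_⟩
      simp only [HasFiniteIntegral, ProbabilityMeasure.coe_mk]
      rw [lintegral_dirac' _ hf.enorm]
      exact enorm_lt_top
  simp only [ProbabilityMeasure.coe_mk, integral_dirac' _ _ hf.stronglyMeasurable] at h
  exact h

/-- Jensen's inequality for averages of finitely many laws. -/
lemma IsConvexFunctional.average_le {α : ProbabilityMeasure E → EReal}
    (hα : IsConvexFunctional α) :
    ∀ (n : ℕ) (P : Fin (n + 1) → ProbabilityMeasure E) (a : Fin (n + 1) → ℝ)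
      (ξ : ProbabilityMeasure E), (∀ i, α (P i) ≤ a i) →
      (ξ : Measure E) = ((n + 1 : ℕ) : ℝ≥0)⁻¹ • ∑ i, (P i : Measure E) →
      α ξ ≤ ((((n + 1 : ℕ) : ℝ)⁻¹ * ∑ i, a i : ℝ) : EReal) := by
  intro n
  induction n with
  | zero =>
    intro P a ξ ha hξ
    have : ξ = P 0 := Subtype.ext (by simpa using hξ)
    simpa [this] using ha 0
  | succ n ih =>
    intro P a ξ ha hξ
    -- Peel off the last law: `ξ` mixes the average `η` of the others with it, with weights
    -- `(n+1)/(n+2)` and `1/(n+2)`.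
    let η : ProbabilityMeasure E := averageLaw fun i => P (Fin.castSucc i)
    have hη : (η : Measure E) = ((n + 1 : ℕ) : ℝ≥0)⁻¹ • ∑ i, (P (Fin.castSucc i) : Measure E) := by
      have : (((n + 1 : ℕ) : ℝ≥0∞))⁻¹ = (((((n + 1 : ℕ) : ℝ≥0))⁻¹ : ℝ≥0) : ℝ≥0∞) := by
        rw [ENNReal.coe_inv (by positivity)]; simp
      simp only [η, averageLaw, ProbabilityMeasure.coe_mk, this]
      rfl
    have h1 := ih _ (fun i => a (Fin.castSucc i)) η (fun i => ha _) hη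
    have h2 := hα η (P (Fin.last _)) ξ ((n + 1 : ℕ) * ((n + 1 + 1 : ℕ) : ℝ≥0)⁻¹)
      ((n + 1 + 1 : ℕ) : ℝ≥0)⁻¹ (by push_cast; field_simp) (by
        rw [hξ, hη, Fin.sum_univ_castSucc, smul_add, smul_smul]
        congr 2
        field_simp)
    refine h2.trans ?_
    refine (add_le_add (mul_le_mul_of_nonneg_left h1 (by exact_mod_cast NNReal.coe_nonneg _))
      (mul_le_mul_of_nonneg_left (ha _) (by exact_mod_cast NNReal.coe_nonneg _))).trans ?_
    rw [← EReal.coe_mul, ← EReal.coe_mul, ← EReal.coe_add]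
    refine le_of_eq (congrArg _ ?_)
    rw [Fin.sum_univ_castSucc a]
    push_cast
    field_simp

end Average

/-! ### Functionals with compact sublevel sets -/

section Functional

variable {E : Type*} [TopologicalSpace E] [MeasurableSpace E]
  {α : ProbabilityMeasure E → EReal}

section T2

variable [OpensMeasurableSpace E] [T2Space (ProbabilityMeasure E)]

lemma lowerSemicontinuous_of_isCompact_sublevel
    (hα : ∀ c : ℝ, IsCompact {ν : ProbabilityMeasure E | α ν ≤ (c : EReal)}) :
    LowerSemicontinuous α := by
  intro ν y hy
  obtain ⟨c, hyc, hc⟩ := EReal.lt_iff_exists_real_btwn.1 hy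
  filter_upwards [(hα c).isClosed.isOpen_compl.mem_nhds (not_le.2 hc)] with μ hμ
  exact hyc.trans (not_le.1 hμ)

/-- Otherwise the nested compact sets `{α ≤ -n}` are all nonempty and share a point, where `α = ⊥`.
-/
lemma exists_neg_le_of_isCompact_sublevel (hbot : ∀ ν, α ν ≠ ⊥)
    (hα : ∀ c : ℝ, IsCompact {ν : ProbabilityMeasure E | α ν ≤ (c : EReal)}) :
    ∃ m : ℝ, 0 ≤ m ∧ ∀ ν, ((-m : ℝ) : EReal) ≤ α ν := by
  by_contra! h
  have hne := IsCompact.nonempty_iInter_of_sequence_nonempty_isCompact_isClosed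
    (fun n : ℕ => {ν : ProbabilityMeasure E | α ν ≤ ((-(n : ℝ) : ℝ) : EReal)})
    (fun n ν hν => le_trans (α := EReal) hν
      (EReal.coe_le_coe_iff.2 (by push_cast; linarith)))
    (fun n => (h n n.cast_nonneg).imp fun ν hν => hν.le) (hα _) fun n => (hα _).isClosed
  obtain ⟨ν, hν⟩ := hne
  rw [Set.mem_iInter] at hν
  refine hbot ν (EReal.eq_bot_iff_forall_lt _ |>.2 fun y => ?_)
  obtain ⟨n, hn⟩ := exists_nat_gt (-y)
  exact (hν n).trans_lt (EReal.coe_lt_coe_iff.2 (by linarith))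

end T2

/-- If the sublevel sets of a convex `α` are precompact in `P_ψ(E)`, then the tails of `ψ` are
controlled by `α`, with an arbitrarily small constant. -/
lemma exists_lintegral_tail_le [OpensMeasurableSpace E] {ψ : C(E, ℝ≥0)}
    (hconv : IsConvexFunctional α) (hproper : ∃ ν, α ν ≠ ⊤) {m : ℝ} (hm0 : 0 ≤ m)
    (hm : ∀ ν, ((-m : ℝ) : EReal) ≤ α ν)
    (hK : ∀ c : ℝ, (∀ ν : ProbabilityMeasure E, α ν ≤ (c : EReal) →
        ∫⁻ x, (ψ x : ℝ≥0∞) ∂(ν : Measure E) < ∞) ∧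
      IsCompact (closure {ν : PsiProb ψ | α ν.toProb ≤ (c : EReal)}))
    {δ : ℝ≥0∞} (hδ : 0 < δ) :
    ∃ R : ℕ, ∀ ν : ProbabilityMeasure E, ∫⁻ x, ((ψ x - R : ℝ≥0) : ℝ≥0∞) ∂(ν : Measure E) ≤
      δ * ((α ν + m).toENNReal + 1) := by
  obtain ⟨ν₀, hν₀⟩ := hproper
  have hne_bot : ∀ ν, α ν ≠ ⊥ := fun ν => ((EReal.bot_lt_coe _).trans_le (hm ν)).ne'
  lift α ν₀ to ℝ using ⟨hν₀, hne_bot _⟩ with a₀ ha₀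
  obtain ⟨R, hR⟩ := PsiProb.exists_lintegral_tail_lt (hK (|a₀| + 1)).2 hδ
  refine ⟨R, fun ν => ?_⟩
  rcases eq_or_ne (α ν) ⊤ with htop | htop
  · simp [htop, hδ.ne']
  have hmν := hm ν
  lift α ν to ℝ using ⟨htop, hne_bot _⟩ with v hv
  rw [EReal.coe_le_coe_iff] at hmν
  have ha : 0 ≤ v + m := by linarith
  -- Giving `ν` weight `1/(a+1)`, with `a = α(ν) + m`, and `ν₀` the rest yields a mixture in the
  -- fixed sublevel set `{α ≤ |a₀| + 1}`, whatever `ν` is.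
  let a : ℝ≥0 := ⟨v + m, ha⟩
  have hav : (a : ℝ) = v + m := rfl
  have hst : a * (a + 1)⁻¹ + (a + 1)⁻¹ = 1 := by field_simp
  let ξ : ProbabilityMeasure E := ⟨(a * (a + 1)⁻¹) • (ν₀ : Measure E) + (a + 1)⁻¹ • (ν : Measure E),
    ⟨by
      simp only [Measure.add_apply, Measure.smul_apply, measure_univ]
      rw [← add_smul, hst, one_smul]⟩⟩
  have hξ : (ξ : Measure E) =
    (a * (a + 1)⁻¹) • (ν₀ : Measure E) + (a + 1)⁻¹ • (ν : Measure E) := rfl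
  have hαξ : α ξ ≤ ((|a₀| + 1 : ℝ) : EReal) := by
    refine (hconv ν₀ ν ξ _ _ hst hξ).trans ?_
    rw [← ha₀, ← hv, ← EReal.coe_mul, ← EReal.coe_mul, ← EReal.coe_add, EReal.coe_le_coe_iff]
    rw [NNReal.coe_mul, NNReal.coe_inv, NNReal.coe_add, NNReal.coe_one]
    have h1 : (0 : ℝ) ≤ a * ((a : ℝ) + 1)⁻¹ := by positivity
    have h2 : (a : ℝ) * ((a : ℝ) + 1)⁻¹ ≤ 1 := by
      rw [mul_inv_le_iff₀ (by positivity)]; linarith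
    have h3 : ((a : ℝ) + 1)⁻¹ * v ≤ 1 := by
      rw [inv_mul_le_iff₀ (by positivity)]; linarith
    have h4 : (a : ℝ) * ((a : ℝ) + 1)⁻¹ * a₀ ≤ |a₀| :=
      (mul_le_mul_of_nonneg_left (le_abs_self a₀) h1).trans
        (mul_le_of_le_one_left (abs_nonneg _) h2)
    linarith
  have hlt := hR ⟨ξ, (hK _).1 ξ hαξ⟩ (subset_closure hαξ)
  simp only [hξ, lintegral_add_measure, lintegral_smul_measure] at hlt
  -- Drop the contribution of `ν₀`; multiplying by `a + 1` then bounds the tail of `ν`.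
  have hle : (a + 1)⁻¹ • ∫⁻ x, ((ψ x - R : ℝ≥0) : ℝ≥0∞) ∂(ν : Measure E) ≤ δ :=
    le_add_self.trans hlt.le
  have e : ((v : EReal) + m).toENNReal + 1 = ((a + 1 : ℝ≥0) : ℝ≥0∞) := by
    rw [← EReal.coe_add, EReal.real_coe_toENNReal, ← hav]; simp
  rw [ENNReal.smul_def, smul_eq_mul, ENNReal.coe_inv (by positivity), mul_comm,
    ← div_eq_mul_inv, ENNReal.div_le_iff (by positivity) ENNReal.coe_ne_top] at hle
  rwa [e]

end Functional

/-! ### Deviation of the empirical measure from the average of the conditional laws -/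

section Deviation

variable {E : Type*}

/-- Truncation of a function at height `1 + R`. -/
noncomputable def truncate (R : ℕ) (f : E → ℝ) (x : E) : ℝ :=
  max (min (f x) (1 + R)) (-(1 + R))

lemma abs_truncate_le (R : ℕ) (f : E → ℝ) (x : E) : |truncate R f x| ≤ 1 + R :=
  abs_le.2 ⟨le_max_right _ _, max_le (min_le_right _ _) (by
    have : (0 : ℝ) ≤ R := R.cast_nonneg
    linarith)⟩

/-- Where `|f|` exceeds `1 + R`, the excess is at most `(1 + ψ) - (1 + R)`; elsewhere nothing is
cut. -/
lemma abs_sub_truncate_le [TopologicalSpace E] {ψ : C(E, ℝ≥0)} (R : ℕ) {f : E → ℝ} (x : E)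
    (hf : |f x| ≤ 1 + (ψ x : ℝ)) : |f x - truncate R f x| ≤ ((ψ x - R : ℝ≥0) : ℝ) := by
  have hR : (0 : ℝ) ≤ R := R.cast_nonneg
  rw [NNReal.coe_sub_def, NNReal.coe_natCast]
  obtain ⟨h1, h2⟩ := abs_le.1 hf
  have h3 := le_max_left ((ψ x : ℝ) - R) 0
  have h4 := le_max_right ((ψ x : ℝ) - R) 0
  rw [truncate, abs_le]
  rcases le_total (f x) (1 + R) with h | h
  · rw [min_eq_left h]
    rcases le_total (f x) (-(1 + R)) with h' | h'
    · rw [max_eq_right h']; constructor <;> linarith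
    · rw [max_eq_left h']; constructor <;> linarith
  · rw [min_eq_right h, max_eq_left (a := 1 + (R : ℝ)) (by linarith)]; constructor <;> linarith

variable [MeasurableSpace E]

lemma measurable_truncate (R : ℕ) {f : E → ℝ} (hf : Measurable f) : Measurable (truncate R f) :=
  (hf.min measurable_const).max measurable_const

variable [TopologicalSpace E] [StandardBorelSpace E] [Nonempty E] {n : ℕ}

/-- An upper bound for the deviation `|∫ f dLₙ - (1/n) ∑ₖ ∫ f dν_{k-1,k}|`, for `|f| ≤ 1 + ψ`: the
deviation for the truncation of `f` at height `1 + R`, plus an error controlled by `(ψ - R)⁺`. -/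
noncomputable def deviation (ψ : C(E, ℝ≥0)) (R : ℕ) (ν : ProbabilityMeasure (Fin n → E))
    (f : E → ℝ) (x : Fin n → E) : ℝ≥0∞ :=
  ENNReal.ofReal |(n : ℝ)⁻¹ * ∑ k, condIncrement ν (truncate R f) k x| +
    (n : ℝ≥0∞)⁻¹ * ∑ k, (((ψ (x k) - R : ℝ≥0) : ℝ≥0∞) +
      ∫⁻ y, ((ψ y - R : ℝ≥0) : ℝ≥0∞) ∂(condLaw ν k x : Measure E))

variable [OpensMeasurableSpace E] {ψ : C(E, ℝ≥0)}

lemma measurable_deviation (R : ℕ) (ν : ProbabilityMeasure (Fin n → E)) {f : E → ℝ}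
    (hf : Measurable f) : Measurable (deviation ψ R ν f) := by
  refine Measurable.add ?_ (Measurable.const_mul (f := fun x => ∑ k,
    (((ψ (x k) - R : ℝ≥0) : ℝ≥0∞) + ∫⁻ y, ((ψ y - R : ℝ≥0) : ℝ≥0∞) ∂(condLaw ν k x : Measure E)))
    (Finset.measurable_fun_sum _ fun k _ => ?_) _)
  · have h := (Finset.measurable_fun_sum Finset.univ fun k _ =>
      measurable_condIncrement ν (measurable_truncate R hf) k).const_mul (n : ℝ)⁻¹
    exact (continuous_abs.measurable.comp h).ennreal_ofReal
  · exact ((PsiProb.measurable_tail ψ R).comp (measurable_pi_apply k)).add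
      (measurable_lintegral_condLaw ν k (PsiProb.measurable_tail ψ R))

lemma ofReal_abs_average_sub_le_deviation (R : ℕ) (ν : ProbabilityMeasure (Fin n → E)) {f : E → ℝ}
    (hm : Measurable f) (hf : ∀ x, |f x| ≤ 1 + (ψ x : ℝ)) {x : Fin n → E}
    (hx : ∀ k, ∫⁻ y, (ψ y : ℝ≥0∞) ∂(condLaw ν k x : Measure E) < ∞) :
    ENNReal.ofReal |(n : ℝ)⁻¹ * ∑ k, f (x k) -
        (n : ℝ)⁻¹ * ∑ k, ∫ y, f y ∂(condLaw ν k x : Measure E)| ≤ deviation ψ R ν f x := by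
  let e : E → ℝ := fun y => f y - truncate R f y
  have he : ∀ y, ‖e y‖ₑ ≤ ((ψ y - R : ℝ≥0) : ℝ≥0∞) := fun y => by
    rw [Real.enorm_eq_ofReal_abs, ← ENNReal.ofReal_coe_nnreal]
    exact ENNReal.ofReal_le_ofReal (abs_sub_truncate_le R y (hf y))
  have hsplit : (n : ℝ)⁻¹ * ∑ k, f (x k) - (n : ℝ)⁻¹ * ∑ k, ∫ y, f y ∂(condLaw ν k x : Measure E) =
      (n : ℝ)⁻¹ * ∑ k, condIncrement ν (truncate R f) k x +
        (n : ℝ)⁻¹ * ∑ k, (e (x k) - ∫ y, e y ∂(condLaw ν k x : Measure E)) := by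
    rw [← mul_sub, ← mul_add, ← Finset.sum_sub_distrib, ← Finset.sum_add_distrib]
    refine congrArg _ (Finset.sum_congr rfl fun k _ => ?_)
    have h1 : ∫ y, e y ∂(condLaw ν k x : Measure E) = ∫ y, f y ∂(condLaw ν k x : Measure E) -
        ∫ y, truncate R f y ∂(condLaw ν k x : Measure E) :=
      integral_sub (PsiProb.integrable_of_le (hx k) hm hf)
        (Integrable.of_bound (measurable_truncate R hm).aestronglyMeasurable (1 + R)
          (Eventually.of_forall (abs_truncate_le R f)))
    rw [h1, condIncrement]
    simp only [e]
    ring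
  rw [hsplit, deviation, ← Real.enorm_eq_ofReal_abs, ← Real.enorm_eq_ofReal_abs]
  refine (enorm_add_le _ _).trans (add_le_add le_rfl ?_)
  have hn : ‖(n : ℝ)⁻¹‖ₑ ≤ (n : ℝ≥0∞)⁻¹ := by
    rcases Nat.eq_zero_or_pos n with rfl | hn
    · simp
    · rw [Real.enorm_eq_ofReal (by positivity),
        ENNReal.ofReal_inv_of_pos (by exact_mod_cast hn), ENNReal.ofReal_natCast]
  rw [enorm_mul]
  refine mul_le_mul' hn ((enorm_sum_le _ _).trans (Finset.sum_le_sum fun k _ => ?_))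
  exact enorm_sub_le.trans (add_le_add (he _)
    ((enorm_integral_le_lintegral_enorm _).trans (lintegral_mono he)))

/-- By the tower property, the tails at the sampled points and under the conditional laws have equal
integrals, hence the factor `2`. -/
lemma lintegral_deviation_le (R : ℕ) (ν : ProbabilityMeasure (Fin n → E)) {f : E → ℝ}
    (hm : Measurable f) {η : ℝ} (hη : 0 < η) :
    ∫⁻ x, deviation ψ R ν f x ∂(ν : Measure (Fin n → E)) ≤
      ENNReal.ofReal (η + (2 * (1 + R)) ^ 2 / (η * n)) +
        (n : ℝ≥0∞)⁻¹ * (2 * ∫⁻ x, ∑ k, ∫⁻ y, ((ψ y - R : ℝ≥0) : ℝ≥0∞)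
          ∂(condLaw ν k x : Measure E) ∂(ν : Measure (Fin n → E))) := by
  have ht := PsiProb.measurable_tail ψ R
  have hx : ∀ k : Fin n, Measurable fun x : Fin n → E => ((ψ (x k) - R : ℝ≥0) : ℝ≥0∞) := fun k =>
    ht.comp (measurable_pi_apply k)
  have hc := fun k => measurable_lintegral_condLaw ν k ht
  have hxc : ∀ k : Fin n, Measurable fun x : Fin n → E => ((ψ (x k) - R : ℝ≥0) : ℝ≥0∞) +
      ∫⁻ y, ((ψ y - R : ℝ≥0) : ℝ≥0∞) ∂(condLaw ν k x : Measure E) := fun k => (hx k).add (hc k)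
  simp only [deviation]
  rw [lintegral_add_right _ ((Finset.measurable_fun_sum _ fun k _ => hxc k).const_mul _),
    lintegral_const_mul _ (Finset.measurable_fun_sum _ fun k _ => hxc k),
    lintegral_finsetSum _ fun k _ => hxc k, lintegral_finsetSum _ fun k _ => hc k]
  refine add_le_add (lintegral_average_condIncrement_le ν (measurable_truncate R hm)
    (abs_truncate_le R f) hη) (mul_le_mul' le_rfl (le_of_eq ?_))
  rw [Finset.mul_sum]
  refine Finset.sum_congr rfl fun k _ => ?_
  rw [lintegral_add_right _ (hc k), lintegral_condLaw ν k ht, two_mul]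

end Deviation

/-! ### Finite sums of extended reals -/

lemma sum_eq_top_or_exists_real {ι : Type*} [Fintype ι] {u : ι → EReal} (hu : ∀ i, u i ≠ ⊥) :
    ∑ i, u i = ⊤ ∨ ∃ a : ι → ℝ, ∀ i, u i = a i := by
  classical
  by_cases h : ∃ i, u i = ⊤
  · obtain ⟨i, hi⟩ := h
    left
    rw [← Finset.add_sum_erase _ _ (Finset.mem_univ i), hi]
    refine EReal.top_add_of_ne_bot (Finset.sum_induction _ (· ≠ ⊥) ?_ (by simp) fun j _ => hu j)
    exact fun a b ha hb => by simp [EReal.add_eq_bot_iff, ha, hb]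
  · push Not at h
    exact Or.inr ⟨fun i => (u i).toReal, fun i => (EReal.coe_toReal (h i) (hu i)).symm⟩

lemma EReal.coe_sum {ι : Type*} (s : Finset ι) (a : ι → ℝ) :
    ((∑ i ∈ s, a i : ℝ) : EReal) = ∑ i ∈ s, (a i : EReal) := by
  classical
  induction s using Finset.induction_on with
  | empty => simp
  | insert i s hi ih => rw [Finset.sum_insert hi, Finset.sum_insert hi, EReal.coe_add, ih]

lemma sum_toENNReal_add_le {n : ℕ} {u : Fin n → EReal} {m : ℝ}
    (hm : ∀ i, ((-m : ℝ) : EReal) ≤ u i) :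
    ∑ i, (u i + m).toENNReal ≤ (∑ i, u i).toENNReal + n * ENNReal.ofReal m := by
  rcases sum_eq_top_or_exists_real fun i => ((EReal.bot_lt_coe _).trans_le (hm i)).ne' with h | h
  · simp [h]
  · obtain ⟨a, ha⟩ := h
    simp only [ha, EReal.coe_le_coe_iff] at hm ⊢
    simp only [← EReal.coe_sum, ← EReal.coe_add, EReal.real_coe_toENNReal]
    rw [← ENNReal.ofReal_sum_of_nonneg fun i _ => by linarith [hm i], Finset.sum_add_distrib]
    refine ENNReal.ofReal_add_le.trans (add_le_add le_rfl ?_)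
    simp [ENNReal.ofReal_mul]

/-! ### Expected deviations and the penalty for leaving a neighbourhood -/

section Deviation

variable {E : Type*} [TopologicalSpace E] [MeasurableSpace E] [StandardBorelSpace E] [Nonempty E]
  [OpensMeasurableSpace E] {ψ : C(E, ℝ≥0)} {n : ℕ}

lemma lintegral_deviation_le_of_tail_le [NeZero n] {R : ℕ} {ν : ProbabilityMeasure (Fin n → E)} {f : E → ℝ}
    (hm : Measurable f) {τ : ℝ} (hτ : 0 < τ) (hn : (2 * (1 + R)) ^ 2 ≤ τ ^ 2 * n)
    (htail : ∫⁻ x, ∑ k, ∫⁻ y, ((ψ y - R : ℝ≥0) : ℝ≥0∞) ∂(condLaw ν k x : Measure E)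
      ∂(ν : Measure (Fin n → E)) ≤ n * ENNReal.ofReal (τ / 2)) :
    ∫⁻ x, deviation ψ R ν f x ∂(ν : Measure (Fin n → E)) ≤ ENNReal.ofReal (3 * τ) := by
  have hn0 : (0 : ℝ) < n := by exact_mod_cast Nat.pos_of_ne_zero (NeZero.ne n)
  -- With `η = τ`, the increments contribute `2τ` and the doubled tails `τ`.
  have h1 : τ + (2 * (1 + R)) ^ 2 / (τ * n) ≤ 2 * τ := by
    have : (2 * (1 + (R : ℝ))) ^ 2 / (τ * n) ≤ τ := by
      rw [div_le_iff₀ (by positivity)]; nlinarith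
    linarith
  calc _ ≤ ENNReal.ofReal (2 * τ) + (n : ℝ≥0∞)⁻¹ * (2 * (n * ENNReal.ofReal (τ / 2))) :=
        (lintegral_deviation_le R ν hm hτ).trans (by gcongr)
    _ = ENNReal.ofReal (2 * τ) + ENNReal.ofReal τ := by
        congr 1
        rw [mul_left_comm 2, ← mul_assoc,
          ENNReal.inv_mul_cancel (by exact_mod_cast NeZero.ne n) (ENNReal.natCast_ne_top n), one_mul,
          ← ENNReal.ofReal_ofNat, ← ENNReal.ofReal_mul (by norm_num)]
        congr 1; ring
    _ = _ := by rw [← ENNReal.ofReal_add (by positivity) hτ.le]; congr 1; ring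

/-- The `+ 1` keeps the denominator positive when `T` is empty or `κ = 0`. -/
lemma lintegral_mul_sum_deviation_le {R : ℕ} {ν : ProbabilityMeasure (Fin n → E)}
    (T : Finset (PsiTest ψ)) {κ θ : ℝ} (hκ : 0 ≤ κ)
    (h : ∀ f ∈ T, ∫⁻ x, deviation ψ R ν f.1 x ∂(ν : Measure (Fin n → E)) ≤
      ENNReal.ofReal (θ / (κ * T.card + 1))) (hθ : 0 ≤ θ) :
    ∫⁻ x, ENNReal.ofReal (n * κ) * ∑ f ∈ T, deviation ψ R ν f.1 x ∂(ν : Measure (Fin n → E)) ≤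
      ENNReal.ofReal (n * θ) := by
  have hd : ∀ f ∈ T, Measurable (deviation ψ R ν f.1) := fun f _ =>
    measurable_deviation R ν f.1.continuous.measurable
  rw [lintegral_const_mul _ (Finset.measurable_fun_sum T hd), lintegral_finsetSum T hd]
  calc _ ≤ ENNReal.ofReal (n * κ) * ∑ _f ∈ T, ENNReal.ofReal (θ / (κ * T.card + 1)) :=
        mul_le_mul' le_rfl (Finset.sum_le_sum h)
    _ = ENNReal.ofReal (n * κ * (T.card * (θ / (κ * T.card + 1)))) := by
        rw [Finset.sum_const, nsmul_eq_mul, ENNReal.ofReal_mul (p := n * κ) (by positivity),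
          ENNReal.ofReal_mul (p := T.card) (by positivity), ENNReal.ofReal_natCast]
    _ ≤ _ := by
        apply ENNReal.ofReal_le_ofReal
        have h1 : κ * T.card / (κ * T.card + 1) ≤ 1 := by
          rw [div_le_one (by positivity)]; linarith
        calc _ = n * θ * (κ * T.card / (κ * T.card + 1)) := by ring
          _ ≤ n * θ * 1 := by gcongr
          _ = _ := mul_one _

/-- A pointwise Markov inequality: one test function off by at least `ε` already makes the penalty
`n(K/ε) ∑ deviation` at least `nK`. This replaces estimating the probability of a bad event. -/
lemma ofReal_le_mul_sum_deviation [NeZero n] (R : ℕ) (ν : ProbabilityMeasure (Fin n → E)) {x : Fin n → E}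
    (hx : ∀ k, ∫⁻ y, (ψ y : ℝ≥0∞) ∂(condLaw ν k x : Measure E) < ∞) {T : Finset (PsiTest ψ)}
    {K ε : ℝ} (hK : 0 ≤ K) (hε : 0 < ε)
    (h : ¬ ∀ f ∈ T, |∫ y, f.1 y ∂(empirical x : Measure E) -
      (n : ℝ)⁻¹ * ∑ k, ∫ y, f.1 y ∂(condLaw ν k x : Measure E)| < ε) :
    ENNReal.ofReal (n * K) ≤ ENNReal.ofReal (n * (K / ε)) * ∑ f ∈ T, deviation ψ R ν f.1 x := by
  push Not at h
  obtain ⟨f, hfT, hf⟩ := h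
  rw [integral_empirical x f.1.continuous.measurable] at hf
  calc ENNReal.ofReal (n * K) = ENNReal.ofReal (n * (K / ε)) * ENNReal.ofReal ε := by
        rw [← ENNReal.ofReal_mul (by positivity)]
        congr 1; field_simp
    _ ≤ _ := mul_le_mul' le_rfl ((ENNReal.ofReal_le_ofReal hf).trans
        ((ofReal_abs_average_sub_le_deviation R ν f.1.continuous.measurable f.2 hx).trans
          (Finset.single_le_sum (f := fun f : PsiTest ψ => deviation ψ R ν f.1 x)
            (fun _ _ => zero_le) hfT)))

end Deviation

lemma continuous_empiricalPsi {E : Type*} [TopologicalSpace E] [MeasurableSpace E]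
    [OpensMeasurableSpace E] {ψ : C(E, ℝ≥0)} {n : ℕ} [NeZero n] :
    Continuous fun x : Fin n → E => empiricalPsi ψ x := by
  refine continuous_iInf_rng.2 fun f => continuous_induced_rng.2 ?_
  have h : ∀ x : Fin n → E, ∫ y, f.1 y ∂((empiricalPsi ψ x).toProb : Measure E) =
      (n : ℝ)⁻¹ * ∑ i, f.1 (x i) := fun x => integral_empirical x f.1.continuous.measurable
  simp only [Function.comp_def, h]
  exact continuous_const.mul (continuous_finsetSum _ fun i _ =>
    f.1.continuous.comp (continuous_apply i))

lemma EReal.natCast_mul_coe (n : ℕ) (a : ℝ) : (n : EReal) * a = ((n * a : ℝ) : EReal) := by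
  rw [EReal.coe_mul]; rfl

lemma EReal.natCast_mul_le_natCast_mul (n : ℕ) {a b : EReal} (h : a ≤ b) :
    (n : EReal) * a ≤ n * b :=
  mul_le_mul_of_nonneg_left h (EReal.coe_nonneg.2 n.cast_nonneg)

/-! ### The lower bound -/

section Lower

variable {E : Type*} [TopologicalSpace E] [MeasurableSpace E] [StandardBorelSpace E] [Nonempty E]
  [OpensMeasurableSpace E] {ψ : C(E, ℝ≥0)} {α : ProbabilityMeasure E → EReal}

/-- The law of large numbers for `F ∘ Lₙ` under product measures. -/
lemma eventually_le_eIntegral_empiricalPsi {F : PsiProb ψ → EReal} (hF : LowerSemicontinuous F)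
    {c : ℝ} (hc : ∀ ν, (c : EReal) ≤ F ν) (P : PsiProb ψ) {z : ℝ} (hz : z < F P) :
    ∀ᶠ n : ℕ in atTop, ∀ ν : ProbabilityMeasure (Fin (n + 1) → E),
      (ν : Measure (Fin (n + 1) → E)) = Measure.pi (fun _ => (P.toProb : Measure E)) →
      (((n + 1 : ℕ) : ℝ) * z : ℝ) ≤ eIntegral (ν : Measure (Fin (n + 1) → E))
        (fun x => ((n + 1 : ℕ) : EReal) * F (empiricalPsi ψ x)) := by
  obtain ⟨a, hza, ha⟩ := EReal.lt_iff_exists_real_btwn.1 hz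
  rw [EReal.coe_lt_coe_iff] at hza
  obtain ⟨T, ε, hε, hT⟩ := PsiProb.exists_finset_of_mem_nhds (hF P a ha)
  set K : ℝ := |a - c|
  have hK : 0 ≤ K := abs_nonneg _
  set θ : ℝ := a - z
  have hθ : 0 < θ := sub_pos.2 hza
  set τ : ℝ := θ / (K / ε * T.card + 1) / 3
  have hτ : 0 < τ := by positivity
  obtain ⟨R, hR⟩ := PsiProb.exists_lintegral_tail_lt (isCompact_singleton (x := P))
    (δ := ENNReal.ofReal (τ / 2)) (by simpa using by positivity)
  have hR := (hR P rfl).le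
  obtain ⟨N₀, hN₀⟩ := exists_nat_ge ((2 * (1 + (R : ℝ))) ^ 2 / τ ^ 2)
  filter_upwards [eventually_ge_atTop N₀] with n hn ν hν
  have hn1 : (2 * (1 + (R : ℝ))) ^ 2 ≤ τ ^ 2 * ((n + 1 : ℕ) : ℝ) := by
    rw [div_le_iff₀ (by positivity)] at hN₀
    have : (N₀ : ℝ) ≤ ((n + 1 : ℕ) : ℝ) := by exact_mod_cast hn.trans n.le_succ
    nlinarith [sq_pos_of_pos hτ]
  have hae := condLaw_pi P.toProb hν
  have htail : ∫⁻ x, ∑ k, ∫⁻ y, ((ψ y - R : ℝ≥0) : ℝ≥0∞) ∂(condLaw ν k x : Measure E)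
      ∂(ν : Measure (Fin (n + 1) → E)) ≤ ((n + 1 : ℕ) : ℝ≥0∞) * ENNReal.ofReal (τ / 2) := by
    calc _ = ∫⁻ _, ((n + 1 : ℕ) : ℝ≥0∞) * ∫⁻ y, ((ψ y - R : ℝ≥0) : ℝ≥0∞) ∂(P.toProb : Measure E)
          ∂(ν : Measure (Fin (n + 1) → E)) := lintegral_congr_ae (hae.mono fun x hx => by simp [hx])
      _ ≤ _ := by
        rw [lintegral_const, measure_univ, mul_one]
        gcongr
  have hdev : ∀ f ∈ T, ∫⁻ x, deviation ψ R ν f.1 x ∂(ν : Measure (Fin (n + 1) → E)) ≤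
      ENNReal.ofReal (θ / (K / ε * T.card + 1)) := fun f _ =>
    (lintegral_deviation_le_of_tail_le f.1.continuous.measurable hτ hn1 htail).trans_eq
      (by congr 1; simp only [τ]; ring)
  have hint := lintegral_mul_sum_deviation_le T (by positivity) hdev hθ.le
  have hmeas : Measurable fun x => ENNReal.ofReal (((n + 1 : ℕ) : ℝ) * (K / ε)) *
      ∑ f ∈ T, deviation ψ R ν f.1 x :=
    (Finset.measurable_fun_sum T fun f _ =>
      measurable_deviation R ν f.1.continuous.measurable).const_mul _
  -- The constant `n a` plays the role of `f` and `n F ∘ Lₙ` that of `G`, so no measurability of `F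
  -- ∘ Lₙ` is needed. Off the neighbourhood, the loss `a - c ≤ K` is paid by the penalty.
  have key := eIntegral_sub_le_add (μ := (ν : Measure (Fin (n + 1) → E)))
    (f := fun _ => ((((n + 1 : ℕ) : ℝ) * a : ℝ) : EReal))
    (G := fun x => ((n + 1 : ℕ) : EReal) * F (empiricalPsi ψ x)) (C := ((n + 1 : ℕ) : ℝ) * a)
    (m := -(((n + 1 : ℕ) : ℝ) * c)) (c := 0) measurable_const hmeas (fun _ => le_rfl)
    (fun x => by
      rw [neg_neg, ← EReal.natCast_mul_coe]
      exact EReal.natCast_mul_le_natCast_mul _ (hc _))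
    (by
      filter_upwards [hae] with x hx
      rw [EReal.coe_zero, add_zero]
      have hlt : ∀ k, ∫⁻ y, (ψ y : ℝ≥0∞) ∂(condLaw ν k x : Measure E) < ∞ := fun k => by
        rw [hx k]; exact P.lintegral_lt_top
      by_cases h : ∀ f ∈ T, |∫ y, f.1 y ∂(empirical x : Measure E) -
          ((n + 1 : ℕ) : ℝ)⁻¹ * ∑ k, ∫ y, f.1 y ∂(condLaw ν k x : Measure E)| < ε
      · have hmem : a < F (empiricalPsi ψ x) := hT (empiricalPsi ψ x) fun f hf => by
          have := h f hf
          simp only [hx, Finset.sum_const, Finset.card_univ, Fintype.card_fin, nsmul_eq_mul] at this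
          rwa [inv_mul_cancel_left₀ (by positivity)] at this
        rw [← EReal.natCast_mul_coe]
        exact (EReal.natCast_mul_le_natCast_mul _ hmem.le).trans
          (le_add_of_nonneg_right (EReal.coe_ennreal_nonneg _))
      · have h1 := ofReal_le_mul_sum_deviation R ν hlt hK hε h
        have h2 : ((((n + 1 : ℕ) : ℝ) * a : ℝ) : EReal) ≤
            ((((n + 1 : ℕ) : ℝ) * c : ℝ) : EReal) + ((((n + 1 : ℕ) : ℝ) * K : ℝ) : EReal) := by
          rw [← EReal.coe_add, EReal.coe_le_coe_iff, ← mul_add]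
          have : a - c ≤ K := le_abs_self _
          gcongr
          linarith
        refine h2.trans (add_le_add ?_ ?_)
        · rw [← EReal.natCast_mul_coe]
          exact EReal.natCast_mul_le_natCast_mul _ (hc _)
        · refine le_trans (le_of_eq ?_) (EReal.coe_ennreal_le_coe_ennreal_iff.2 h1)
          rw [EReal.coe_ennreal_ofReal, max_eq_left (by positivity)])
  rw [eIntegral_const, EReal.coe_zero, zero_add] at key
  have key' := key.trans (EReal.coe_ennreal_le_coe_ennreal_iff.2 hint)
  rw [EReal.coe_ennreal_ofReal, max_eq_left (by positivity)] at key'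
  rw [EReal.sub_le_iff_le_add (.inr (EReal.coe_ne_top _)) (.inr (EReal.coe_ne_bot _))] at key'
  have : ((((n + 1 : ℕ) : ℝ) * z : ℝ) : EReal) =
      ((((n + 1 : ℕ) : ℝ) * a : ℝ) : EReal) - ((((n + 1 : ℕ) : ℝ) * θ : ℝ) : EReal) := by
    rw [← EReal.coe_sub]; congr 1; simp only [θ]; ring
  rw [this]
  exact EReal.sub_le_of_le_add' key'

theorem iSup_le_liminf_rhoN_div (hα : ∀ ν, α ν ≠ ⊥) {F : PsiProb ψ → EReal}
    (hF : LowerSemicontinuous F) {c : ℝ} (hc : ∀ ν, (c : EReal) ≤ F ν) :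
    (⨆ ν : PsiProb ψ, (F ν - α ν.toProb)) ≤
      liminf (fun n : ℕ =>
        rhoN α (fun x : Fin (n + 1) → E => ((n + 1 : ℕ) : EReal) * F (empiricalPsi ψ x)) /
          ((n + 1 : ℕ) : EReal)) atTop := by
  refine iSup_le fun P => ?_
  rcases eq_or_ne (α P.toProb) ⊤ with htop | htop
  · simp [htop]
  lift α P.toProb to ℝ using ⟨htop, hα _⟩ with v hv
  refine EReal.sub_le_of_le_add ?_
  rw [← EReal.ge_of_forall_gt_iff_ge]
  intro z hz
  rw [← EReal.sub_le_iff_le_add (by simp) (by simp)]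
  refine le_liminf_of_le (by isBoundedDefault) ?_
  filter_upwards [eventually_le_eIntegral_empiricalPsi hF hc P hz] with n hn
  let ν : ProbabilityMeasure (Fin (n + 1) → E) :=
    ⟨Measure.pi fun _ => (P.toProb : Measure E), inferInstance⟩
  have h1 := hn ν rfl
  have h2 : alphaN α ν = ((((n + 1 : ℕ) : ℝ) * v : ℝ) : EReal) := by
    rw [alphaN_pi α P.toProb rfl, ← hv, EReal.natCast_mul_coe]
  rw [EReal.le_div_iff_mul_le (by positivity) (EReal.natCast_ne_top _)]
  refine le_trans ?_ (le_iSup _ ν)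
  rw [h2]
  refine le_trans (le_of_eq ?_) (EReal.sub_le_sub h1 le_rfl)
  rw [← EReal.coe_sub, mul_comm, EReal.natCast_mul_coe, ← EReal.coe_sub]
  congr 1; ring

end Lower

/-! ### The upper bound -/

section Upper

/-- Near each `ν₀ ∈ K`, a level `b` between `F ν₀ - s` and `α ν₀` gives `F < b + s` by upper
semicontinuity and `b < α` by lower semicontinuity. Halving `ε` leaves room to move both `ν` and
`μ`; compactness makes `T` and `ε` uniform. -/
lemma exists_uniform_neighbourhood {E : Type*} [TopologicalSpace E] [MeasurableSpace E]
    [OpensMeasurableSpace E] {ψ : C(E, ℝ≥0)} {α : ProbabilityMeasure E → EReal}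
    (hα : LowerSemicontinuous α) {F : PsiProb ψ → EReal} (hF : UpperSemicontinuous F) {s : ℝ}
    {K : Set (PsiProb ψ)} (hK : IsCompact K) (hs : ∀ ν ∈ K, F ν - s < α ν.toProb) :
    ∃ T : Finset (PsiTest ψ), ∃ ε : ℝ, 0 < ε ∧ ∀ ν ∈ K, ∀ μ : PsiProb ψ,
      (∀ f ∈ T, |∫ x, f.1 x ∂(μ.toProb : Measure E) - ∫ x, f.1 x ∂(ν.toProb : Measure E)| < ε) →
        F μ ≤ α ν.toProb + s := by
  classical
  refine hK.induction_on (p := fun A => ∃ T : Finset (PsiTest ψ), ∃ ε : ℝ, 0 < ε ∧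
    ∀ ν ∈ A, ∀ μ : PsiProb ψ,
      (∀ f ∈ T, |∫ x, f.1 x ∂(μ.toProb : Measure E) - ∫ x, f.1 x ∂(ν.toProb : Measure E)| < ε) →
        F μ ≤ α ν.toProb + s) ⟨∅, 1, one_pos, by simp⟩ ?_ ?_ ?_
  · rintro A B hAB ⟨T, ε, hε, h⟩
    exact ⟨T, ε, hε, fun ν hν => h ν (hAB hν)⟩
  · rintro A B ⟨T, ε, hε, h⟩ ⟨T', ε', hε', h'⟩
    refine ⟨T ∪ T', min ε ε', lt_min hε hε', fun ν hν μ hμ => ?_⟩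
    rcases hν with hν | hν
    · exact h ν hν μ fun f hf =>
        (hμ f (Finset.mem_union_left _ hf)).trans_le (min_le_left _ _)
    · exact h' ν hν μ fun f hf =>
        (hμ f (Finset.mem_union_right _ hf)).trans_le (min_le_right _ _)
  · intro ν₀ hν₀
    obtain ⟨b, hFb, hbα⟩ := EReal.lt_iff_exists_real_btwn.1 (hs ν₀ hν₀)
    have hFb' : F ν₀ < ((b + s : ℝ) : EReal) := by
      rw [EReal.coe_add]
      exact (EReal.sub_lt_iff (by simp) (by simp)).1 hFb
    obtain ⟨T, ε, hε, hT⟩ := PsiProb.exists_finset_of_mem_nhds (hF ν₀ _ hFb')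
    have hW : ∀ᶠ ν in 𝓝 ν₀, ∀ f ∈ T, |∫ x, f.1 x ∂(ν.toProb : Measure E) -
        ∫ x, f.1 x ∂(ν₀.toProb : Measure E)| < ε / 2 :=
      (Finset.eventually_all T).2 fun f _ => by
        have := Metric.tendsto_nhds.1 ((PsiProb.continuous_integral f).tendsto ν₀)
          (ε / 2) (half_pos hε)
        simpa only [Real.dist_eq] using this
    have hA : ∀ᶠ ν : PsiProb ψ in 𝓝 ν₀, b < α ν.toProb :=
      (PsiProb.continuous_toProb (ψ := ψ)).continuousAt.eventually (hα ν₀.toProb b hbα)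
    refine ⟨_, mem_nhdsWithin_of_mem_nhds (hW.and hA), T, ε / 2, half_pos hε, ?_⟩
    rintro ν ⟨h1, h2⟩ μ hμ
    have hmem : F μ < ((b + s : ℝ) : EReal) := hT μ fun f hf => by
      calc _ ≤ _ := abs_sub_le _ (∫ x, f.1 x ∂(ν.toProb : Measure E)) _
        _ < ε / 2 + ε / 2 := add_lt_add (hμ f hf) (h1 f hf)
        _ = ε := add_halves ε
    refine hmem.le.trans ?_
    rw [EReal.coe_add]
    exact add_le_add h2.le le_rfl

variable {E : Type*} [TopologicalSpace E] [PolishSpace E] [MeasurableSpace E] [BorelSpace E]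
  {ψ : C(E, ℝ≥0)} {α : ProbabilityMeasure E → EReal} {F : PsiProb ψ → EReal}

lemma measurable_mul_comp_empiricalPsi (hF : UpperSemicontinuous F) (n : ℕ) [NeZero n] :
    Measurable fun x : Fin n → E => (n : EReal) * F (empiricalPsi ψ x) :=
  (UpperSemicontinuous.measurable
    (hF.comp continuous_empiricalPsi)).const_mul (n : EReal)

variable [Nonempty E]

/-- For costly `ν` the crude estimate `nC - (nB - nm) ≤ ns` suffices. -/
lemma sub_alphaN_le_of_le_lintegral {n : ℕ} [NeZero n] {ν : ProbabilityMeasure (Fin n → E)}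
    {m C B s : ℝ} (hm0 : 0 ≤ m) (hm : ∀ ν, ((-m : ℝ) : EReal) ≤ α ν) (hB0 : 0 ≤ B)
    (hB : C + m - s ≤ B) (hC : ∀ ν, F ν ≤ C)
    (h : ENNReal.ofReal (n * B) ≤ ∫⁻ x, (∑ k, α (condLaw ν k x)).toENNReal
      ∂(ν : Measure (Fin n → E))) :
    eIntegral (ν : Measure (Fin n → E)) (fun x => (n : EReal) * F (empiricalPsi ψ x)) -
      alphaN α ν ≤ ((n * s : ℝ) : EReal) := by
  have h1 : eIntegral (ν : Measure (Fin n → E)) (fun x => (n : EReal) * F (empiricalPsi ψ x)) ≤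
      ((n * C : ℝ) : EReal) := eIntegral_le_of_le fun x => by
    rw [← EReal.natCast_mul_coe]; exact EReal.natCast_mul_le_natCast_mul _ (hC _)
  have h2 : ∫⁻ x, (-∑ k, α (condLaw ν k x)).toENNReal ∂(ν : Measure (Fin n → E)) ≤
      ENNReal.ofReal (n * m) := lintegral_toENNReal_le_ofReal fun x => by
    rw [EReal.neg_le, ← EReal.coe_neg]
    calc ((-(n * m) : ℝ) : EReal) = ∑ _k : Fin n, ((-m : ℝ) : EReal) := by
          rw [← EReal.coe_sum]; simp
      _ ≤ _ := Finset.sum_le_sum fun k _ => hm _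
  have h3 : ((n * B - n * m : ℝ) : EReal) ≤ alphaN α ν := by
    rw [EReal.coe_sub]
    refine EReal.sub_le_sub ?_ ?_
    · refine le_trans (le_of_eq ?_) (EReal.coe_ennreal_le_coe_ennreal_iff.2 h)
      rw [EReal.coe_ennreal_ofReal, max_eq_left (by positivity)]
    · refine (EReal.coe_ennreal_le_coe_ennreal_iff.2 h2).trans (le_of_eq ?_)
      rw [EReal.coe_ennreal_ofReal, max_eq_left (by positivity)]
  refine (EReal.sub_le_sub h1 h3).trans ?_
  rw [← EReal.coe_sub, EReal.coe_le_coe_iff]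
  have : (n : ℝ) * (C + m - s) ≤ n * B := by gcongr
  linarith

lemma lintegral_sum_tail_le {n : ℕ} {ν : ProbabilityMeasure (Fin n → E)} {R : ℕ} {m B δ : ℝ}
    (hm0 : 0 ≤ m) (hB : 0 ≤ B) (hδ : 0 ≤ δ) (hm : ∀ ν, ((-m : ℝ) : EReal) ≤ α ν)
    (hR : ∀ ν : ProbabilityMeasure E, ∫⁻ x, ((ψ x - R : ℝ≥0) : ℝ≥0∞) ∂(ν : Measure E) ≤
      ENNReal.ofReal δ * ((α ν + m).toENNReal + 1))
    (h : ∫⁻ x, (∑ k, α (condLaw ν k x)).toENNReal ∂(ν : Measure (Fin n → E)) ≤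
      ENNReal.ofReal (n * B)) :
    ∫⁻ x, ∑ k, ∫⁻ y, ((ψ y - R : ℝ≥0) : ℝ≥0∞) ∂(condLaw ν k x : Measure E)
      ∂(ν : Measure (Fin n → E)) ≤ n * ENNReal.ofReal (δ * (B + m + 1)) := by
  calc _ ≤ ∫⁻ x, ENNReal.ofReal δ * ((∑ k, α (condLaw ν k x)).toENNReal +
        (n * ENNReal.ofReal m + n)) ∂(ν : Measure (Fin n → E)) := lintegral_mono fun x => by
        refine (Finset.sum_le_sum fun k _ => hR (condLaw ν k x)).trans ?_
        rw [← Finset.mul_sum, Finset.sum_add_distrib, ← add_assoc]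
        refine mul_le_mul' le_rfl (add_le_add (sum_toENNReal_add_le fun k => hm _) ?_)
        simp
    _ = ENNReal.ofReal δ * (∫⁻ x, (∑ k, α (condLaw ν k x)).toENNReal
        ∂(ν : Measure (Fin n → E)) + (n * ENNReal.ofReal m + n)) := by
        rw [lintegral_const_mul' _ _ ENNReal.ofReal_ne_top, lintegral_add_right _ measurable_const]
        simp
    _ ≤ ENNReal.ofReal δ * (ENNReal.ofReal (n * B) + (n * ENNReal.ofReal m + n)) := by gcongr
    _ = _ := by
        rw [ENNReal.ofReal_mul n.cast_nonneg, ENNReal.ofReal_natCast, ENNReal.ofReal_mul hδ,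
          ENNReal.ofReal_add (by positivity) one_pos.le, ENNReal.ofReal_add hB hm0,
          ENNReal.ofReal_one]
        ring

/-- If `F(Lₙ) ≤ α(L) + s`, Jensen's inequality concludes. Otherwise `α(L) ≤ M`, because `F ≤ C ≤ M +
s`, so `Lₙ` must be far from `L`; the penalty `nK` then covers the gap between `F ≤ C` and `α ≥ -m`.
-/
lemma mul_comp_empiricalPsi_le {n : ℕ} {ν : ProbabilityMeasure (Fin (n + 1) → E)}
    {m C K s M ε : ℝ} (hconv : IsConvexFunctional α) (hm : ∀ ν, ((-m : ℝ) : EReal) ≤ α ν)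
    (hψ : ∀ c : ℝ, ∀ ν : ProbabilityMeasure E, α ν ≤ (c : EReal) →
      ∫⁻ x, (ψ x : ℝ≥0∞) ∂(ν : Measure E) < ∞)
    (hC : ∀ ν, F ν ≤ C) (hM : C - s ≤ M) (hK0 : 0 ≤ K) (hK : C + m - s ≤ K) (hε : 0 < ε)
    {T : Finset (PsiTest ψ)}
    (hT : ∀ ν : PsiProb ψ, α ν.toProb ≤ (M : EReal) → ∀ μ : PsiProb ψ,
      (∀ f ∈ T, |∫ x, f.1 x ∂(μ.toProb : Measure E) - ∫ x, f.1 x ∂(ν.toProb : Measure E)| < ε) →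
        F μ ≤ α ν.toProb + s) (R : ℕ) (x : Fin (n + 1) → E) :
    ((n + 1 : ℕ) : EReal) * F (empiricalPsi ψ x) ≤
      ∑ k, α (condLaw ν k x) + ((((n + 1 : ℕ) : ℝ) * s : ℝ) : EReal) +
        ((ENNReal.ofReal (((n + 1 : ℕ) : ℝ) * (K / ε)) *
          ∑ f ∈ T, deviation ψ R ν f.1 x : ℝ≥0∞) : EReal) := by
  have hbot : ∀ ν, α ν ≠ ⊥ := fun ν => ((EReal.bot_lt_coe _).trans_le (hm ν)).ne'
  rcases sum_eq_top_or_exists_real fun k => hbot (condLaw ν k x) with htop | ⟨a, ha⟩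
  · rw [htop, EReal.top_add_coe, EReal.top_add_of_ne_bot (EReal.coe_ennreal_ne_bot _)]
    exact le_top
  have hsum : ∑ k, α (condLaw ν k x) = ((∑ k, a k : ℝ) : EReal) := by
    rw [EReal.coe_sum]; exact Finset.sum_congr rfl fun k _ => ha k
  rw [hsum, ← EReal.coe_add]
  set L := averageLaw fun k => condLaw ν k x
  have hL : α L ≤ ((((n + 1 : ℕ) : ℝ)⁻¹ * ∑ k, a k : ℝ) : EReal) :=
    hconv.average_le n (fun k => condLaw ν k x) a L (fun k => (ha k).le) (by
      have : (((n + 1 : ℕ) : ℝ≥0∞))⁻¹ = (((((n + 1 : ℕ) : ℝ≥0))⁻¹ : ℝ≥0) : ℝ≥0∞) := by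
        rw [ENNReal.coe_inv (by positivity)]; simp
      simp only [L, averageLaw, ProbabilityMeasure.coe_mk, this]
      rfl)
  have hψk : ∀ k, ∫⁻ y, (ψ y : ℝ≥0∞) ∂(condLaw ν k x : Measure E) < ∞ := fun k =>
    hψ (a k) _ (ha k).le
  by_cases hgood : F (empiricalPsi ψ x) ≤ α L + s
  · refine le_trans ?_ (le_add_of_nonneg_right (EReal.coe_ennreal_nonneg _))
    have h1 : F (empiricalPsi ψ x) ≤ ((((n + 1 : ℕ) : ℝ)⁻¹ * ∑ k, a k + s : ℝ) : EReal) := by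
      rw [EReal.coe_add]; exact hgood.trans (add_le_add hL le_rfl)
    refine (EReal.natCast_mul_le_natCast_mul _ h1).trans (le_of_eq ?_)
    rw [EReal.natCast_mul_coe, mul_add, mul_inv_cancel_left₀ (by positivity)]
  · have hLM : α L ≤ M := by
      by_contra! hlt
      refine hgood ((hC _).trans ?_)
      calc (C : EReal) ≤ ((M + s : ℝ) : EReal) := EReal.coe_le_coe_iff.2 (by linarith)
        _ = (M : EReal) + s := EReal.coe_add _ _
        _ ≤ _ := add_le_add hlt.le le_rfl
    have hbad : ¬ ∀ f ∈ T, |∫ y, f.1 y ∂(empirical x : Measure E) -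
        ((n + 1 : ℕ) : ℝ)⁻¹ * ∑ k, ∫ y, f.1 y ∂(condLaw ν k x : Measure E)| < ε := fun h => by
      refine hgood (hT ⟨L, hψ M L hLM⟩ hLM (empiricalPsi ψ x) fun f hf => ?_)
      have := h f hf
      rwa [← integral_averageLaw _ fun k =>
        PsiProb.integrable_of_le (hψk k) f.1.continuous.measurable f.2] at this
    have h1 := EReal.coe_ennreal_le_coe_ennreal_iff.2
      (ofReal_le_mul_sum_deviation R ν hψk hK0 hε hbad)
    rw [EReal.coe_ennreal_ofReal, max_eq_left (by positivity)] at h1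
    have h2 : -(((n + 1 : ℕ) : ℝ) * m) ≤ ∑ k, a k := by
      calc _ = ∑ _k : Fin (n + 1), -m := by simp
        _ ≤ _ := Finset.sum_le_sum fun k _ => EReal.coe_le_coe_iff.1 ((hm _).trans (ha k).le)
    calc _ ≤ ((((n + 1 : ℕ) : ℝ) * C : ℝ) : EReal) := by
          rw [← EReal.natCast_mul_coe]; exact EReal.natCast_mul_le_natCast_mul _ (hC _)
      _ ≤ ((∑ k, a k + ((n + 1 : ℕ) : ℝ) * s + ((n + 1 : ℕ) : ℝ) * K : ℝ) : EReal) := by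
          rw [EReal.coe_le_coe_iff]
          have : ((n + 1 : ℕ) : ℝ) * (C + m - s) ≤ ((n + 1 : ℕ) : ℝ) * K := by gcongr
          linarith
      _ ≤ _ := by rw [EReal.coe_add]; exact add_le_add le_rfl h1

theorem limsup_rhoN_div_le_iSup (hbot : ∀ ν, α ν ≠ ⊥) (hproper : ∃ ν, α ν ≠ ⊤)
    (hconv : IsConvexFunctional α)
    (hcompact : ∀ c : ℝ, IsCompact {ν : ProbabilityMeasure E | α ν ≤ (c : EReal)})
    (hψ : ∀ c : ℝ, (∀ ν : ProbabilityMeasure E, α ν ≤ (c : EReal) →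
        ∫⁻ x, (ψ x : ℝ≥0∞) ∂(ν : Measure E) < ∞) ∧
      IsCompact (closure {ν : PsiProb ψ | α ν.toProb ≤ (c : EReal)}))
    (hF : UpperSemicontinuous F) {C : ℝ} (hC : ∀ ν, F ν ≤ C) :
    limsup (fun n : ℕ =>
      rhoN α (fun x : Fin (n + 1) → E => ((n + 1 : ℕ) : EReal) * F (empiricalPsi ψ x)) /
        ((n + 1 : ℕ) : EReal)) atTop ≤ ⨆ ν : PsiProb ψ, (F ν - α ν.toProb) := by
  obtain ⟨m, hm0, hm⟩ := exists_neg_le_of_isCompact_sublevel hbot hcompact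
  rw [← EReal.le_of_forall_lt_iff_le]
  intro z hz
  -- The slack `z - s` will absorb the expected deviations.
  obtain ⟨s, hs, hsz⟩ := EReal.lt_iff_exists_real_btwn.1 hz
  rw [EReal.coe_lt_coe_iff] at hsz
  have hsup : ∀ ν : PsiProb ψ, F ν - s < α ν.toProb := fun ν => by
    have h1 : F ν - α ν.toProb < s := (le_iSup (fun ν : PsiProb ψ => F ν - α ν.toProb) ν).trans_lt hs
    have hFtop : F ν ≠ ⊤ := ((hC ν).trans_lt (EReal.coe_lt_top _)).ne
    rw [EReal.sub_lt_iff (.inl (hbot _)) (.inr hFtop)] at h1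
    rw [EReal.sub_lt_iff (.inl (EReal.coe_ne_bot _)) (.inl (EReal.coe_ne_top _)), add_comm]
    exact h1
  -- Only the level `C - s` matters: above it, `F ≤ C ≤ α + s` is automatic.
  obtain ⟨T, ε, hε, hT⟩ := exists_uniform_neighbourhood
    (lowerSemicontinuous_of_isCompact_sublevel hcompact) hF (hψ (C - s)).2 fun ν _ => hsup ν
  set B : ℝ := max 0 (C + m - s)
  have hB0 : 0 ≤ B := le_max_left _ _
  have hB : C + m - s ≤ B := le_max_right _ _
  set θ : ℝ := z - s
  have hθ : 0 < θ := sub_pos.2 hsz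
  set τ : ℝ := θ / (B / ε * T.card + 1) / 3
  have hτ : 0 < τ := by positivity
  -- Chosen so that the average conditional tail is at most `τ / 2` when the integrated positive
  -- cost is at most `nB`. Since `B` does not depend on `ν`, neither do `R` and the threshold for
  -- `n`.
  set δ : ℝ := τ / 2 / (B + m + 1)
  have hδ : 0 < δ := by positivity
  obtain ⟨R, hR⟩ := exists_lintegral_tail_le hconv hproper hm0 hm hψ
    (δ := ENNReal.ofReal δ) (by simpa using hδ)
  obtain ⟨N₀, hN₀⟩ := exists_nat_ge ((2 * (1 + (R : ℝ))) ^ 2 / τ ^ 2)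
  refine limsup_le_of_le (by isBoundedDefault) ?_
  filter_upwards [eventually_ge_atTop N₀] with n hn
  have hn1 : (2 * (1 + (R : ℝ))) ^ 2 ≤ τ ^ 2 * ((n + 1 : ℕ) : ℝ) := by
    rw [div_le_iff₀ (by positivity)] at hN₀
    have : (N₀ : ℝ) ≤ ((n + 1 : ℕ) : ℝ) := by exact_mod_cast hn.trans n.le_succ
    nlinarith [sq_pos_of_pos hτ]
  rw [EReal.div_le_iff_le_mul (by positivity) (EReal.natCast_ne_top _),
    EReal.natCast_mul_coe]
  refine iSup_le fun ν => ?_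
  rcases le_total (ENNReal.ofReal (((n + 1 : ℕ) : ℝ) * B)) (∫⁻ x, (∑ k, α (condLaw ν k x)).toENNReal
      ∂(ν : Measure (Fin (n + 1) → E))) with hlarge | hsmall
  · refine (sub_alphaN_le_of_le_lintegral hm0 hm hB0 hB hC hlarge).trans ?_
    rw [EReal.coe_le_coe_iff]
    gcongr
  have htail := lintegral_sum_tail_le hm0 hB0 hδ.le hm hR hsmall
  rw [show δ * (B + m + 1) = τ / 2 by simp only [δ]; field_simp] at htail
  have hdev : ∀ f ∈ T, ∫⁻ x, deviation ψ R ν f.1 x ∂(ν : Measure (Fin (n + 1) → E)) ≤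
      ENNReal.ofReal (θ / (B / ε * T.card + 1)) := fun f _ =>
    (lintegral_deviation_le_of_tail_le f.1.continuous.measurable hτ hn1 htail).trans_eq
      (by congr 1; simp only [τ]; ring)
  have hint := lintegral_mul_sum_deviation_le T (by positivity) hdev hθ.le
  have hmeas : Measurable fun x => ENNReal.ofReal (((n + 1 : ℕ) : ℝ) * (B / ε)) *
      ∑ f ∈ T, deviation ψ R ν f.1 x :=
    (Finset.measurable_fun_sum T fun f _ =>
      measurable_deviation R ν f.1.continuous.measurable).const_mul _
  have key := eIntegral_sub_le_add (μ := (ν : Measure (Fin (n + 1) → E)))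
    (f := fun x => ((n + 1 : ℕ) : EReal) * F (empiricalPsi ψ x))
    (G := fun x => ∑ k, α (condLaw ν k x)) (C := ((n + 1 : ℕ) : ℝ) * C)
    (m := ((n + 1 : ℕ) : ℝ) * m) (c := ((n + 1 : ℕ) : ℝ) * s)
    (measurable_mul_comp_empiricalPsi hF _) hmeas
    (fun x => by
      rw [← EReal.natCast_mul_coe]; exact EReal.natCast_mul_le_natCast_mul _ (hC _))
    (fun x => by
      calc _ = ∑ _k : Fin (n + 1), ((-m : ℝ) : EReal) := by rw [← EReal.coe_sum]; simp
        _ ≤ _ := Finset.sum_le_sum fun k _ => hm _)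
    (Eventually.of_forall fun x => mul_comp_empiricalPsi_le hconv hm (fun c => (hψ c).1) hC le_rfl
      hB0 hB hε (fun ν hν => hT ν (subset_closure hν)) R x)
  refine key.trans ((add_le_add le_rfl (EReal.coe_ennreal_le_coe_ennreal_iff.2 hint)).trans ?_)
  rw [EReal.coe_ennreal_ofReal, max_eq_left (by positivity), ← EReal.coe_add, EReal.coe_le_coe_iff,
    ← mul_add]
  simp [θ]

end Upper

theorem theorem3p1 {E : Type*} [TopologicalSpace E] [PolishSpace E] [MeasurableSpace E]
    [BorelSpace E] [Nonempty E]
    (α : ProbabilityMeasure E → EReal)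
    (hα_bot : ∀ ν, α ν ≠ ⊥)
    (hα_proper : ∃ ν, α ν ≠ ⊤)
    (hα_convex : IsConvexFunctional α)
    (hα_compact : ∀ c : ℝ, IsCompact {ν : ProbabilityMeasure E | α ν ≤ (c : EReal)}) :
    (∀ ψ : C(E, ℝ≥0),
      -- lower bound
      (∀ F : PsiProb ψ → EReal, LowerSemicontinuous F → (∃ c : ℝ, ∀ ν, (c : EReal) ≤ F ν) →
        (⨆ ν : PsiProb ψ, (F ν - α ν.toProb)) ≤
          liminf (fun n : ℕ =>
            rhoN α (fun x : Fin (n + 1) → E => ((n + 1 : ℕ) : EReal) * F (empiricalPsi ψ x)) /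
              ((n + 1 : ℕ) : EReal)) atTop) ∧
      -- upper bound, if the sublevel sets are precompact subsets of `P_ψ(E)`
      ((∀ c : ℝ,
          (∀ ν : ProbabilityMeasure E, α ν ≤ (c : EReal) →
            ∫⁻ x, (ψ x : ℝ≥0∞) ∂(ν : Measure E) < ∞) ∧
          IsCompact (closure {ν : PsiProb ψ | α ν.toProb ≤ (c : EReal)})) →
        ∀ F : PsiProb ψ → EReal, UpperSemicontinuous F → (∃ c : ℝ, ∀ ν, F ν ≤ (c : EReal)) →
          limsup (fun n : ℕ =>
            rhoN α (fun x : Fin (n + 1) → E => ((n + 1 : ℕ) : EReal) * F (empiricalPsi ψ x)) /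
              ((n + 1 : ℕ) : EReal)) atTop ≤
            ⨆ ν : PsiProb ψ, (F ν - α ν.toProb))) ∧
    -- the limit for bounded weakly continuous functions on `P(E)`
    (∀ F : ProbabilityMeasure E →ᵇ ℝ,
      Tendsto (fun n : ℕ =>
          rhoN α (fun x : Fin (n + 1) → E => ((n + 1 : ℕ) : EReal) * (F (empirical x) : EReal)) /
            ((n + 1 : ℕ) : EReal)) atTop
        (𝓝 (⨆ ν : ProbabilityMeasure E, ((F ν : EReal) - α ν)))) := by
  refine ⟨fun ψ => ⟨fun F hF ⟨c, hc⟩ => iSup_le_liminf_rhoN_div hα_bot hF hc,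
    fun hψ F hF ⟨c, hc⟩ => limsup_rhoN_div_le_iSup hα_bot hα_proper hα_convex hα_compact hψ hF hc⟩,
    fun F => ?_⟩
  -- For `ψ = 0` the space `P_ψ(E)` is `P(E)` with its weak topology, and the tail condition reduces
  -- to compactness of the sublevel sets.
  let G : PsiProb (0 : C(E, ℝ≥0)) → EReal := fun ν => (F ν.toProb : EReal)
  have hG : Continuous G := continuous_coe_real_ereal.comp
    (F.continuous.comp PsiProb.continuous_toProb)
  have hF : ∀ ν, |F ν| ≤ ‖F‖ := fun ν => F.norm_coe_le_norm ν
  have hsup : ⨆ ν : PsiProb (0 : C(E, ℝ≥0)), (G ν - α ν.toProb) =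
      ⨆ ν : ProbabilityMeasure E, ((F ν : EReal) - α ν) :=
    Function.Surjective.iSup_comp (f := PsiProb.toProb) (fun ν => ⟨PsiProb.ofProb ν, rfl⟩)
      fun ν => (F ν : EReal) - α ν
  have hcompact : ∀ c : ℝ, IsCompact
      {ν : PsiProb (0 : C(E, ℝ≥0)) | α ν.toProb ≤ (c : EReal)} := fun c => by
    have h := (hα_compact c).image PsiProb.continuous_ofProb
    convert h using 1
    ext ν
    exact ⟨fun hν => ⟨ν.toProb, hν, rfl⟩, fun ⟨μ, hμ, hμν⟩ => hμν ▸ hμ⟩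
  have hclosed : ∀ c : ℝ, IsClosed
      {ν : PsiProb (0 : C(E, ℝ≥0)) | α ν.toProb ≤ (c : EReal)} := fun c =>
    (hα_compact c).isClosed.preimage PsiProb.continuous_toProb
  have hlower := iSup_le_liminf_rhoN_div hα_bot hG.lowerSemicontinuous (c := -‖F‖) fun ν =>
    EReal.coe_le_coe_iff.2 (neg_le_of_abs_le (hF _))
  have hupper := limsup_rhoN_div_le_iSup hα_bot hα_proper hα_convex hα_compact
    (fun c => ⟨fun ν _ => by simp, (hclosed c).closure_eq.symm ▸ hcompact c⟩)
    hG.upperSemicontinuous (C := ‖F‖) fun ν => EReal.coe_le_coe_iff.2 (le_of_abs_le (hF _))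
  rw [hsup] at hlower hupper
  exact tendsto_of_le_liminf_of_limsup_le hlower hupper
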